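/- **Problem.** Let $V$ be a set of $n$ elements, $n\ge 2$ even. A *partition* is a map $p:V\to\{0,1\}$ with $|p^{-1}(0)|=|p^{-1}(1)|=n/2$, and $\mathrm{dist}(p,p')=|\{v: p(v)\ne p'(v)\}|$. An input $\mathcal I$ consists of an initial partition $p_0$ and a finite sequence of pairs $(u_1,v_1),\dots,(u_T,v_T)$ of elements of $V$. In step $t$ an online algorithm is given $(u_t,v_t)$, pays $1$ if $p_{t-1}(u_t)\neq p_{t-1}(v_t)$ and $0$ otherwise, then chooses a partition $p_t$ and pays $\mathrm{dist}(p_{t-1},p_t)$. Let $\mathrm{Opt}(\mathcal I)$ be the minimum total cost over all sequences $p_1,\dots,p_T$ of partitions. A randomized online algorithm $\mathrm{Alg}$ is *$\gamma$-competitive* (against an oblivious adversary) if there is $\beta$, independent of the input, with $\mathbb E[\mathrm{Alg}(\mathcal I)]\le\gamma\cdot\mathrm{Opt}(\mathcal I)+\beta$ for every input $\mathcal I$. **Notation.** For a partition $\mathcal C$ of $V$ into components, let $\mathcal P(\mathcal C)$ be the set of partitions $p$ that are constant on every component of $\mathcal C$. Put $q=\lceil n^{1/7}\rceil$, $w=4q^4+2$,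 $d=\lceil n^{13/14}/\sqrt{\log n}\,\rceil$ (with $\log=\log_2$). For $g\in\{1,\dots,q\}$ let $R(g)$ be the set of multiples of $g$ in $\{1,\dots,q\}$, and let $R(\infty)=\emptyset$, $\gcd(\emptyset)=\infty$. Let $\mathcal P^g_\ell(\mathcal C)$ be the set of those $p\in\mathcal P(\mathcal C)$ for which each of the two clusters contains at least $\ell$ components of $\mathcal C$ with sizes in $R(g)$. **The algorithm ICB.** ICB works in epochs. An epoch begins with all components being singletons, with $g=1$, and in its first stage. A request to two elements of the same component is ignored. For any other request, the two components that contain the requested elements are merged, giving $\mathcal C$. Let $p$ be the current partition. * If $\mathcal P(\mathcal C)=\emptyset$, then $p$ is kept, the epoch ends, and the next request starts a new epoch. * Otherwise, if the epoch is in its first stage, let $B$ be the set of those $i\in\{1,\dots,q\}$ for which $\mathcal C$ has at least $w$ components of size $i$, and replace $g$ by $\gcd(R(g)\cap B)$. If $\mathcal P^{g}_{2d}(\mathcal C)=\emptyset$, the first stage ends, and the second stage begins with this very request. Otherwise let $p^*\in\mathcal P(\mathcal C)$ minimize $\mathrm{dist}(p,p^*)$; if $p^*\in\mathcal P^{g}_{d}(\mathcal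 C)$ then ICB switches to $p^*$, and if not, it switches to any element of $\mathcal P^{g}_{2d}(\mathcal C)$. * In the second stage, if $p\in\mathcal P(\mathcal C)$ then $p$ is kept; otherwise ICB switches to a partition chosen uniformly at random from $\mathcal P(\mathcal C)$, with fresh randomness. The choices that the first stage leaves open (among the minimizers $p^*$, and in $\mathcal P^{g}_{2d}(\mathcal C)$) are made by an arbitrary fixed rule, which may depend on all requests and partitions so far. **Theorem.** There is an absolute constant $C>0$ such that for every even $n\ge 2$, every set $V$ of $n$ elements, and every rule for the choices left open, ICB is $C\,n^{27/14}\sqrt{\log n}$-competitive for the online bisection problem on $V$. That is, ICB is $O(n^{27/14}\sqrt{\log n})$-competitive, without resource augmentation and for arbitrary request sequences. -/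

import Mathlib

namespace OnlineBisection

open scoped ENNReal NNReal

/-! ### The online bisection problem -/

section Problem

variable (V : Type*) [Fintype V] [DecidableEq V]

/-- A valid partition of `V` into the clusters `0` and `1`: each cluster contains exactly half of
the elements. -/
abbrev Bisection : Type _ :=
  {p : V → Fin 2 // ∀ y : Fin 2, 2 * (Finset.univ.filter fun v => p v = y).card = Fintype.card V}

/-- A randomized online algorithm, given by its behaviour. When the requests `r₁, …, r_{t-1}` have
been served, the partitions so far were `p₀, …, p_{t-1}`, and the request `r_t` arrives, then
`A [r_{t-1}, …, r₁] r_t [p_{t-2}, …, p₀] p_{t-1}` is the law of the next partition `p_t`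
(the lists have the most recent entry first). -/
abbrev OnlineAlgorithm : Type _ :=
  List (V × V) → V × V → List (Bisection V) → Bisection V → PMF (Bisection V)

variable {V}

/-- The number of elements that change their cluster. -/
def dist (p p' : Bisection V) : ℕ := hammingDist p.1 p'.1

/-- The service cost of the request `r` in the partition `p`. -/
def serviceCost (p : Bisection V) (r : V × V) : ℕ := if p.1 r.1 ≠ p.1 r.2 then 1 else 0

/-- The total cost on the initial partition `p₀` and the requests `[r₁, …, r_T]` of moving through
the partitions `[p₁, …, p_T]`: in step `t`, the service cost of `r_t` in `p_{t-1}`, and then the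
reorganization cost `dist p_{t-1} p_t`. -/
def cost : Bisection V → List (V × V) → List (Bisection V) → ℕ
  | p, r :: rs, p' :: ps => serviceCost p r + dist p p' + cost p' rs ps
  | _, _, _ => 0

/-- The optimal offline cost. -/
noncomputable def opt (p₀ : Bisection V) (I : List (V × V)) : ℕ :=
  sInf {k | ∃ ps : List (Bisection V), ps.length = I.length ∧ cost p₀ I ps = k}

/-- The law of the partitions `[p_t, …, p_T]` that the algorithm `A` goes through on the
remaining requests `[r_t, …, r_T]`, given the history before step `t`. -/
noncomputable def run (A : OnlineAlgorithm V) :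
    List (V × V) → List (Bisection V) → Bisection V → List (V × V) → PMF (List (Bisection V))
  | _, _, _, [] => PMF.pure []
  | reqs, past, cur, r :: rs =>
      (A reqs r past cur).bind fun p =>
        (run A (r :: reqs) (cur :: past) p rs).map fun ps => p :: ps

/-- The expected total cost of `A` on the input `(p₀, I)`. The input is fixed in advance, so the
adversary is oblivious. -/
noncomputable def expectedCost (A : OnlineAlgorithm V) (p₀ : Bisection V) (I : List (V × V)) :
    ℝ≥0∞ :=
  ∑' ps : List (Bisection V), run A [] [] p₀ I ps * (cost p₀ I ps : ℝ≥0∞)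

/-- `A` is `γ`-competitive: there is `β`, independent of the input, such that the expected cost
is at most `γ · opt + β` on every input. -/
def IsCompetitive (A : OnlineAlgorithm V) (γ : ℝ) : Prop :=
  ∃ β : ℝ≥0, ∀ (p₀ : Bisection V) (I : List (V × V)),
    expectedCost A p₀ I ≤ ENNReal.ofReal (γ * (opt p₀ I : ℝ) + (β : ℝ))

end Problem

/-! ### Components and component-preserving partitions -/

section Components

variable {V : Type*} [Fintype V] [DecidableEq V]

/-- The initial set of singleton components. -/
def singletons (V : Type*) [Fintype V] [DecidableEq V] : Finset (Finset V) :=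
  Finset.univ.image fun v => {v}

/-- The component in `C` that contains `u` (the components in `C` partition `V`). -/
def comp (C : Finset (Finset V)) (u : V) : Finset V := (C.filter fun c => u ∈ c).biUnion id

/-- Merge the component of `u` and the component of `v`. -/
def merge (C : Finset (Finset V)) (u v : V) : Finset (Finset V) :=
  insert (comp C u ∪ comp C v) ((C.erase (comp C u)).erase (comp C v))

/-- The set `P(C)` of all `C`-preserving partitions. -/
def preserving (C : Finset (Finset V)) : Finset (Bisection V) :=
  Finset.univ.filter fun p => ∀ c ∈ C, ∀ u ∈ c, ∀ v ∈ c, p.1 u = p.1 v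

/-- The number of components of size `i`. -/
def cnt (C : Finset (Finset V)) (i : ℕ) : ℕ := (C.filter fun c => c.card = i).card

/-- The number of components of size `i` that are on side `y` in the partition `p`. -/
def cntSide (C : Finset (Finset V)) (p : Bisection V) (y : Fin 2) (i : ℕ) : ℕ :=
  (C.filter fun c => (∀ v ∈ c, p.1 v = y) ∧ c.card = i).card

/-- The partitions in `P(C)` that are closest to `p`. -/
def closest (C : Finset (Finset V)) (p : Bisection V) : Finset (Bisection V) :=
  (preserving C).filter fun p' => ∀ p'' ∈ preserving C, dist p p' ≤ dist p p''

theorem closest_nonempty {C : Finset (Finset V)} (h : (preserving C).Nonempty)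
    (p : Bisection V) : (closest C p).Nonempty := by
  obtain ⟨p', hp', hmin⟩ := Finset.exists_min_image (preserving C) (dist p) h
  exact ⟨p', Finset.mem_filter.mpr ⟨hp', hmin⟩⟩

end Components

/-! ### The algorithm ICB -/

section Parameters

/-- `q = ⌈n^(1/7)⌉`; sizes greater than `q` are large, the others are small. -/
noncomputable def paramQ (n : ℕ) : ℕ := ⌈(n : ℝ) ^ (1 / 7 : ℝ)⌉₊

/-- `w = 4 q⁴ + 2`, the popularity threshold. -/
noncomputable def paramW (n : ℕ) : ℕ := 4 * paramQ n ^ 4 + 2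

/-- `d = ⌈n^(13/14) / √(log n)⌉`. -/
noncomputable def paramD (n : ℕ) : ℕ :=
  ⌈(n : ℝ) ^ (13 / 14 : ℝ) / √(Real.logb 2 (n : ℝ))⌉₊

/-- `R(g)`, the multiples of `g` in `{1, …, q}`. Here and below the value `g = ∞` is written as
`g = 0`: then `R(g) = ∅`, as no positive number is a multiple of `0`. -/
def multiples (q g : ℕ) : Finset ℕ := (Finset.Icc 1 q).filter fun i => g ∣ i

end Parameters

section Algorithm

variable {V : Type*} [Fintype V] [DecidableEq V]

/-- The set of popular small component sizes. -/
noncomputable def popular (C : Finset (Finset V)) : Finset ℕ :=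
  (Finset.Icc 1 (paramQ (Fintype.card V))).filter fun i => paramW (Fintype.card V) ≤ cnt C i

/-- The update `g_t = gcd (R(g_{t-1}) ∩ B_t)` of the popularity estimator. The value `gcd ∅ = ∞`
is written as `0`, which is also what `Finset.gcd` returns. -/
noncomputable def nextEstimator (C : Finset (Finset V)) (g : ℕ) : ℕ :=
  (multiples (paramQ (Fintype.card V)) g ∩ popular C).gcd id

/-- The `(g, l)`-balanced `C`-preserving partitions. -/
noncomputable def balanced (C : Finset (Finset V)) (g l : ℕ) : Finset (Bisection V) :=
  (preserving C).filter fun p =>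
    ∀ y : Fin 2, l ≤ ∑ i ∈ multiples (paramQ (Fintype.card V)) g, cntSide C p y i

variable (V) in
/-- What ICB remembers besides the partition: the components of the current epoch, the popularity
estimator, and whether the epoch is in its second stage. It depends on the requests only. -/
structure EpochState where
  comps : Finset (Finset V)
  estimator : ℕ
  secondStage : Prop

variable (V) in
/-- The state at the beginning of an epoch. -/
def EpochState.start : EpochState V := ⟨singletons V, 1, False⟩

open scoped Classical in
/-- The state after a request. Requests within a component are ignored. If no partition preserves
the new components, then the next request starts a new epoch. The first stage ends when there is
no `(g_t, 2d)`-balanced partition. -/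
noncomputable def EpochState.next (s : EpochState V) (r : V × V) : EpochState V :=
  if comp s.comps r.1 = comp s.comps r.2 then s
  else
    let C := merge s.comps r.1 r.2
    if preserving C = ∅ then EpochState.start V
    else
      let g := nextEstimator C s.estimator
      ⟨C, g, s.secondStage ∨ balanced C g (2 * paramD (Fintype.card V)) = ∅⟩

/-- The state after the requests in the list (the most recent one first). -/
noncomputable def epochState : List (V × V) → EpochState V
  | [] => EpochState.start V
  | r :: rs => (epochState rs).next r

variable (V) in
/-- A rule for the choices that ICB leaves open. Given the requests and the partitions so far (the
most recent ones first), it selects an element from any nonempty set of partitions. -/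
abbrev TieRule : Type _ :=
  List (V × V) → List (Bisection V) → (S : Finset (Bisection V)) → S.Nonempty →
    {p : Bisection V // p ∈ S}

open scoped Classical in
/-- The algorithm ICB, with the rule `tie` for its arbitrary choices. In the first stage, the
candidate is a closest `C_t`-preserving partition, which is kept if it is `(g_t, d)`-balanced and
is otherwise replaced by a `(g_t, 2d)`-balanced partition. In the second stage, which includes the
step in which the first stage ends, the partition changes only if it is not `C_t`-preserving, and
then to a uniformly random `C_t`-preserving one. -/
noncomputable def icb (tie : TieRule V) : OnlineAlgorithm V := fun reqs r past cur =>
  let s := epochState reqs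
  let d := paramD (Fintype.card V)
  if comp s.comps r.1 = comp s.comps r.2 then PMF.pure cur
  else
    let C := merge s.comps r.1 r.2
    if hC : (preserving C).Nonempty then
      let g := nextEstimator C s.estimator
      if hB : ¬ s.secondStage ∧ (balanced C g (2 * d)).Nonempty then
        let candidate := (tie (r :: reqs) (cur :: past) (closest C cur) (closest_nonempty hC cur)).1
        if candidate ∈ balanced C g d then PMF.pure candidate
        else PMF.pure (tie (r :: reqs) (cur :: past) (balanced C g (2 * d)) hB.2).1
      else if cur ∈ preserving C then PMF.pure cur
      else PMF.uniformOfFinset (preserving C) hC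
    else PMF.pure cur

end Algorithm

end OnlineBisection

/-! The ratio is the expected cost of one epoch. If a schedule pays nothing during an epoch, its
partition stays in P(C); when P(C) becomes empty, every schedule has therefore paid at least 1 since
the epoch began. So `opt` is at least the number of completed epochs (`epochEnds_le_opt`), and the
last, unfinished epoch goes into β.

First stage. Call a merge expensive if it changes g or if neither merged size lies in R(g), and
cheap otherwise. `expensivePotential` starts at q²w + n, never increases within an epoch and drops
by q at every expensive merge, so there are at most qw + n/q of these, each paid with O(n). At a
cheap merge the size of one merged component is a multiple of g, and g is the gcd of popular sizes.
Bézout's identity, with coefficients reduced modulo an available size, then gives sets of components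
of equal total size, at most q⁴, whose swap between the clusters reunites the two merged components
(`exists_preserving_merge_near`). So the closest partition is at distance at most 2q⁴, provided that
both clusters have at least q⁵ + 2 components with sizes in R(g); the balance d ensures this for
large n. Rebalancing costs up to n, but the missing balance must first grow from 0 to about d, by
O(q⁴) per cheap merge, so this too is amortized (`firstStagePotential_step`).

Second stage. When no (g, 2d)-balanced partition exists, a partition in P(C) is determined by a
side, fewer than 2d components with sizes in R(g) on it, and the sides of the components with other
sizes. The potential bounds the number of the latter by qw + n/q, so P(C) has at most M = 2 · n^(2d)
· 2^(qw + n/q) elements (`card_preserving_le`). After the first resampling, the current partition is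
uniform in P(C) at every step, as the adversary is oblivious. If |P(C)| falls from m to m', a new
resampling has probability 1 - m'/m ≤ log m - log m', so the sum telescopes to O(n log M)
(`uniformCost_resample`).

With s = n^(1/14) and L = √(log n), the three contributions are bounded by constant multiples of
s²³L, s²⁶ and s²⁷L, up to lower-order terms. -/

namespace OnlineBisection

open scoped ENNReal NNReal

/-! ### Partitions into components, and the lower bound on the offline optimum -/

section Partitions

variable {V : Type*} [Fintype V] [DecidableEq V]

/-- `C` is a partition of `V` into nonempty components. -/
structure IsPart (C : Finset (Finset V)) : Prop where
  nonempty : ∀ c ∈ C, c.Nonempty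
  cover : ∀ u, ∃ c ∈ C, u ∈ c
  unique : ∀ c ∈ C, ∀ c' ∈ C, ∀ u, u ∈ c → u ∈ c' → c = c'

theorem isPart_singletons : IsPart (singletons V) := by
  constructor
  · intro c hc
    obtain ⟨v, -, rfl⟩ := Finset.mem_image.mp hc
    exact Finset.singleton_nonempty v
  · intro u
    exact ⟨{u}, Finset.mem_image_of_mem _ (Finset.mem_univ u), Finset.mem_singleton_self u⟩
  · intro c hc c' hc' u hu hu'
    obtain ⟨v, -, rfl⟩ := Finset.mem_image.mp hc
    obtain ⟨v', -, rfl⟩ := Finset.mem_image.mp hc'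
    rw [Finset.mem_singleton] at hu hu'
    rw [← hu, hu']

theorem card_singletons : (singletons V).card = Fintype.card V := by
  rw [singletons, Finset.card_image_of_injective _ Finset.singleton_injective, Finset.card_univ]

theorem mem_preserving_singletons (p : Bisection V) : p ∈ preserving (singletons V) := by
  simp [preserving, singletons]

theorem mem_preserving_start (p : Bisection V) :
    p ∈ preserving (EpochState.start V).comps := mem_preserving_singletons p

namespace IsPart

variable {C : Finset (Finset V)}

theorem comp_eq (hC : IsPart C) {c : Finset V} (hc : c ∈ C) {u : V} (hu : u ∈ c) :
    comp C u = c := by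
  have : C.filter (fun c => u ∈ c) = {c} := by
    ext c'
    simp only [Finset.mem_filter, Finset.mem_singleton]
    constructor
    · rintro ⟨h, h'⟩
      exact hC.unique c' h c hc u h' hu
    · rintro rfl
      exact ⟨hc, hu⟩
  rw [comp, this, Finset.singleton_biUnion, id]

theorem comp_mem (hC : IsPart C) (u : V) : comp C u ∈ C := by
  obtain ⟨c, hc, hu⟩ := hC.cover u
  rwa [hC.comp_eq hc hu]

theorem mem_comp (hC : IsPart C) (u : V) : u ∈ comp C u := by
  obtain ⟨c, hc, hu⟩ := hC.cover u
  rwa [hC.comp_eq hc hu]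

theorem disjoint (hC : IsPart C) {c c' : Finset V} (hc : c ∈ C) (hc' : c' ∈ C) (h : c ≠ c') :
    Disjoint c c' := by
  rw [Finset.disjoint_left]
  intro u hu hu'
  exact h (hC.unique c hc c' hc' u hu hu')

theorem mem_merge_iff (u v : V) (c : Finset V) :
    c ∈ merge C u v ↔ c = comp C u ∪ comp C v ∨ (c ∈ C ∧ c ≠ comp C u ∧ c ≠ comp C v) := by
  simp only [merge, Finset.mem_insert, Finset.mem_erase]
  tauto

theorem union_ne (hC : IsPart C) {u v : V} {c : Finset V} (hc : c ∈ C)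
    (hu : c ≠ comp C u) : c ≠ comp C u ∪ comp C v := by
  rintro rfl
  exact hu (hC.unique _ hc _ (hC.comp_mem u) u
    (Finset.mem_union_left _ (hC.mem_comp u)) (hC.mem_comp u))

theorem merge (hC : IsPart C) (u v : V) : IsPart (merge C u v) := by
  have key : ∀ c ∈ C, c ≠ comp C u → c ≠ comp C v → ∀ x ∈ c, x ∉ comp C u ∪ comp C v := by
    intro c hc h1 h2 x hx hx'
    rcases Finset.mem_union.mp hx' with hx' | hx'
    · exact h1 (hC.unique _ hc _ (hC.comp_mem u) x hx hx')
    · exact h2 (hC.unique _ hc _ (hC.comp_mem v) x hx hx')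
  constructor
  · intro c hc
    rcases (mem_merge_iff u v c).mp hc with rfl | ⟨hc, -, -⟩
    · exact ⟨u, Finset.mem_union_left _ (hC.mem_comp u)⟩
    · exact hC.nonempty c hc
  · intro x
    by_cases hx : x ∈ comp C u ∪ comp C v
    · exact ⟨_, (mem_merge_iff u v _).mpr (Or.inl rfl), hx⟩
    · refine ⟨comp C x, (mem_merge_iff u v _).mpr (Or.inr ⟨hC.comp_mem x, ?_, ?_⟩), hC.mem_comp x⟩
      · intro h
        exact hx (Finset.mem_union_left _ (h ▸ hC.mem_comp x))
      · intro h
        exact hx (Finset.mem_union_right _ (h ▸ hC.mem_comp x))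
  · intro c hc c' hc' x hx hx'
    rcases (mem_merge_iff u v c).mp hc with rfl | ⟨hc, h1, h2⟩ <;>
      rcases (mem_merge_iff u v c').mp hc' with rfl | ⟨hc', h1', h2'⟩
    · rfl
    · exact absurd hx (key c' hc' h1' h2' x hx')
    · exact absurd hx' (key c hc h1 h2 x hx)
    · exact hC.unique c hc c' hc' x hx hx'

theorem sum_merge (hC : IsPart C) {u v : V} (h : comp C u ≠ comp C v) (f : Finset V → ℕ) :
    ∑ c ∈ OnlineBisection.merge C u v, f c + (f (comp C u) + f (comp C v)) =
      ∑ c ∈ C, f c + f (comp C u ∪ comp C v) := by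
  rw [OnlineBisection.merge, Finset.sum_insert]
  · have h1 := Finset.add_sum_erase C f (hC.comp_mem u)
    have h2 := Finset.add_sum_erase (C.erase (comp C u)) f
      (Finset.mem_erase.mpr ⟨h.symm, hC.comp_mem v⟩)
    omega
  · intro hm
    simp only [Finset.mem_erase] at hm
    exact hC.union_ne hm.2.2 hm.2.1 rfl

theorem card_merge (hC : IsPart C) {u v : V} (h : comp C u ≠ comp C v) :
    (OnlineBisection.merge C u v).card + 1 = C.card := by
  have := hC.sum_merge h fun _ => 1
  simp only [Finset.sum_const, smul_eq_mul, mul_one] at this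
  omega

theorem card_union_comp (hC : IsPart C) {u v : V} (h : comp C u ≠ comp C v) :
    (comp C u ∪ comp C v).card = (comp C u).card + (comp C v).card :=
  Finset.card_union_of_disjoint (hC.disjoint (hC.comp_mem u) (hC.comp_mem v) h)

theorem eq_of_comp_eq (hC : IsPart C) {p : Bisection V} (hp : p ∈ preserving C) {u v : V}
    (h : comp C u = comp C v) : p.1 u = p.1 v :=
  (Finset.mem_filter.mp hp).2 _ (hC.comp_mem u) u (hC.mem_comp u) v (h ▸ hC.mem_comp v)

/-- A merge adds a single constraint, so P(C) only shrinks within an epoch, and a partition in P(C)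
is lost exactly when it pays for the request. -/
theorem mem_preserving_merge (hC : IsPart C) {u v : V} {p : Bisection V} :
    p ∈ preserving (OnlineBisection.merge C u v) ↔ p ∈ preserving C ∧ p.1 u = p.1 v := by
  simp only [preserving, Finset.mem_filter, Finset.mem_univ, true_and]
  constructor
  · intro hp
    have hm := hp _ ((mem_merge_iff u v _).mpr (Or.inl rfl))
    refine ⟨fun c hc x hx y hy => ?_, hm u (Finset.mem_union_left _ (hC.mem_comp u)) v
      (Finset.mem_union_right _ (hC.mem_comp v))⟩
    by_cases h1 : c = comp C u
    · exact hm x (Finset.mem_union_left _ (h1 ▸ hx)) y (Finset.mem_union_left _ (h1 ▸ hy))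
    by_cases h2 : c = comp C v
    · exact hm x (Finset.mem_union_right _ (h2 ▸ hx)) y (Finset.mem_union_right _ (h2 ▸ hy))
    exact hp c ((mem_merge_iff u v _).mpr (Or.inr ⟨hc, h1, h2⟩)) x hx y hy
  · rintro ⟨hp, huv⟩ c hc x hx y hy
    rcases (mem_merge_iff u v c).mp hc with rfl | ⟨hc, -, -⟩
    · have key : ∀ x ∈ comp C u ∪ comp C v, p.1 x = p.1 u := by
        intro x hx
        rcases Finset.mem_union.mp hx with hx | hx
        · exact hp _ (hC.comp_mem u) x hx u (hC.mem_comp u)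
        · rw [huv]
          exact hp _ (hC.comp_mem v) x hx v (hC.mem_comp v)
      rw [key x hx, key y hy]
    · exact hp c hc x hx y hy

end IsPart

theorem dist_le_card (p p' : Bisection V) : dist p p' ≤ Fintype.card V :=
  hammingDist_le_card_fintype

theorem one_le_dist {p p' : Bisection V} (h : p ≠ p') : 1 ≤ dist p p' :=
  hammingDist_pos.mpr fun h' => h (Subtype.ext h')

theorem serviceCost_le_one (p : Bisection V) (r : V × V) : serviceCost p r ≤ 1 := by
  unfold serviceCost
  split_ifs <;> simp

/-! ### The offline optimum -/

/-- The number of epochs that end while the given requests are served from the state `s`. -/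
noncomputable def epochEnds : EpochState V → List (V × V) → ℕ
  | _, [] => 0
  | s, r :: rs =>
      (if comp s.comps r.1 ≠ comp s.comps r.2 ∧ preserving (merge s.comps r.1 r.2) = ∅
        then 1 else 0) + epochEnds (s.next r) rs

theorem EpochState.next_of_eq {s : EpochState V} {r : V × V}
    (h : comp s.comps r.1 = comp s.comps r.2) : s.next r = s := by
  rw [EpochState.next, if_pos h]

theorem EpochState.next_of_empty {s : EpochState V} {r : V × V}
    (h : comp s.comps r.1 ≠ comp s.comps r.2) (hP : preserving (merge s.comps r.1 r.2) = ∅) :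
    s.next r = EpochState.start V := by
  rw [EpochState.next, if_neg h]
  exact if_pos hP

theorem EpochState.next_of_nonempty {s : EpochState V} {r : V × V}
    (h : comp s.comps r.1 ≠ comp s.comps r.2) (hP : preserving (merge s.comps r.1 r.2) ≠ ∅) :
    s.next r = ⟨merge s.comps r.1 r.2,
      nextEstimator (merge s.comps r.1 r.2) s.estimator,
      s.secondStage ∨ balanced (merge s.comps r.1 r.2)
        (nextEstimator (merge s.comps r.1 r.2) s.estimator)
          (2 * paramD (Fintype.card V)) = ∅⟩ := by
  rw [EpochState.next, if_neg h]
  exact if_neg hP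

theorem EpochState.isPart_next {s : EpochState V} (hs : IsPart s.comps) (r : V × V) :
    IsPart (s.next r).comps := by
  by_cases h : comp s.comps r.1 = comp s.comps r.2
  · rwa [EpochState.next_of_eq h]
  by_cases hP : preserving (merge s.comps r.1 r.2) = ∅
  · rw [EpochState.next_of_empty h hP]
    exact isPart_singletons
  · rw [EpochState.next_of_nonempty h hP]
    exact hs.merge _ _

theorem isPart_epochState (reqs : List (V × V)) : IsPart (epochState reqs).comps := by
  induction reqs with
  | nil => exact isPart_singletons
  | cons r rs ih => exact EpochState.isPart_next ih r

/-- The indicator of p ∉ P(C) is a debt: a partition leaves P(C) only by paying a service cost or by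
moving, and that unit is kept until the epoch ends. The debt is cleared at the start of the next
epoch, where every partition preserves the singletons. -/
theorem epochEnds_le_cost (rs : List (V × V)) : ∀ (s : EpochState V), IsPart s.comps →
    ∀ (p : Bisection V) (ps : List (Bisection V)), ps.length = rs.length →
      epochEnds s rs ≤ cost p rs ps + (if p ∈ preserving s.comps then 0 else 1) := by
  induction rs with
  | nil => intro s _ p ps _; simp [epochEnds]
  | cons r rs ih =>
    intro s hs p ps hlen
    obtain _ | ⟨p', ps⟩ := ps
    · simp at hlen
    have IH := ih (s.next r) (EpochState.isPart_next hs r) p' ps (by simpa using hlen)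
    have hd : p ≠ p' → 1 ≤ dist p p' := one_le_dist
    simp only [epochEnds, cost]
    by_cases h : comp s.comps r.1 = comp s.comps r.2
    · rw [EpochState.next_of_eq h] at IH ⊢
      have : ¬ (comp s.comps r.1 ≠ comp s.comps r.2 ∧
        preserving (merge s.comps r.1 r.2) = ∅) := fun h' => h'.1 h
      rw [if_neg this]
      by_cases hpp : p = p'
      · subst hpp; omega
      · have := hd hpp
        split_ifs at IH ⊢ <;> omega
    by_cases hP : preserving (merge s.comps r.1 r.2) = ∅
    · rw [if_pos ⟨h, hP⟩]
      rw [EpochState.next_of_empty h hP] at IH ⊢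
      rw [if_pos (mem_preserving_start p')] at IH
      by_cases hp : p ∈ preserving s.comps
      · have : serviceCost p r = 1 := by
          rw [serviceCost, if_pos]
          intro h'
          have := hs.mem_preserving_merge.mpr ⟨hp, h'⟩
          rw [hP] at this
          exact absurd this (Finset.notMem_empty p)
        rw [if_pos hp]
        omega
      · rw [if_neg hp]
        omega
    · rw [if_neg fun h' => hP h'.2]
      rw [EpochState.next_of_nonempty h hP] at IH ⊢
      simp only at IH
      by_cases hp : p ∈ preserving s.comps
      · rw [if_pos hp]
        by_cases hr : p.1 r.1 = p.1 r.2
        · by_cases hpp : p = p'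
          · subst hpp
            rw [if_pos (hs.mem_preserving_merge.mpr ⟨hp, hr⟩)] at IH
            omega
          · have := hd hpp
            split_ifs at IH <;> omega
        · have : serviceCost p r = 1 := by rw [serviceCost, if_pos hr]
          split_ifs at IH <;> omega
      · rw [if_neg hp]
        split_ifs at IH <;> omega

theorem epochEnds_le_opt (p₀ : Bisection V) (I : List (V × V)) :
    epochEnds (EpochState.start V) I ≤ opt p₀ I := by
  obtain ⟨ps, hlen, hps⟩ := Nat.sInf_mem (s := {k | ∃ ps : List (Bisection V),
    ps.length = I.length ∧ cost p₀ I ps = k}) ⟨_, List.replicate I.length p₀, by simp, rfl⟩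
  have := epochEnds_le_cost I (EpochState.start V) isPart_singletons p₀ ps hlen
  rw [if_pos (mem_preserving_start p₀), hps] at this
  exact this

end Partitions

/-! ### Expected cost as a backward recursion, and the individual steps of ICB -/

section Expectation

theorem tsum_bind_mul {α β : Type*} (m : PMF α) (f : α → PMF β) (h : β → ℝ≥0∞) :
    ∑' b, m.bind f b * h b = ∑' a, m a * ∑' b, f a b * h b := by
  simp only [PMF.bind_apply, ← ENNReal.tsum_mul_right, ← ENNReal.tsum_mul_left]
  rw [ENNReal.tsum_comm]
  simp only [mul_assoc]

theorem tsum_pure_mul {α : Type*} (a : α) (h : α → ℝ≥0∞) :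
    ∑' b, PMF.pure a b * h b = h a := by
  rw [tsum_eq_single a]
  · simp [PMF.pure_apply]
  · intro b hb
    simp [PMF.pure_apply, hb]

theorem tsum_map_mul {α β : Type*} (m : PMF α) (f : α → β) (h : β → ℝ≥0∞) :
    ∑' b, m.map f b * h b = ∑' a, m a * h (f a) := by
  rw [PMF.map, tsum_bind_mul]
  simp only [Function.comp_apply, tsum_pure_mul]

variable {V : Type*} [Fintype V] [DecidableEq V]

/-- The expected cost of serving the remaining requests, as a real number. -/
noncomputable def costToGo (A : OnlineAlgorithm V) :
    List (V × V) → List (Bisection V) → Bisection V → List (V × V) → ℝ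
  | _, _, _, [] => 0
  | reqs, past, cur, r :: rs =>
      serviceCost cur r + ∑ p, (A reqs r past cur p).toReal *
        (dist cur p + costToGo A (r :: reqs) (cur :: past) p rs)

theorem costToGo_nonneg (A : OnlineAlgorithm V) (rs : List (V × V)) :
    ∀ reqs past cur, 0 ≤ costToGo A reqs past cur rs := by
  induction rs with
  | nil => intros; exact le_rfl
  | cons r rs ih =>
    intro reqs past cur
    rw [costToGo]
    have : ∀ p, 0 ≤ costToGo A (r :: reqs) (cur :: past) p rs := fun p => ih _ _ _
    exact add_nonneg (Nat.cast_nonneg _) (Finset.sum_nonneg fun p _ =>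
      mul_nonneg ENNReal.toReal_nonneg (add_nonneg (Nat.cast_nonneg _) (this p)))

theorem tsum_run_eq (A : OnlineAlgorithm V) (rs : List (V × V)) : ∀ reqs past cur,
    ∑' ps, run A reqs past cur rs ps * (cost cur rs ps : ℝ≥0∞) =
      ENNReal.ofReal (costToGo A reqs past cur rs) := by
  induction rs with
  | nil => intros; simp [cost, costToGo]
  | cons r rs ih =>
    intro reqs past cur
    have hJ : ∀ p, 0 ≤ costToGo A (r :: reqs) (cur :: past) p rs :=
      fun p => costToGo_nonneg A rs _ _ _
    rw [run, tsum_bind_mul]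
    have inner : ∀ p, ∑' ps, ((run A (r :: reqs) (cur :: past) p rs).map fun ps => p :: ps) ps *
        (cost cur (r :: rs) ps : ℝ≥0∞) =
        (serviceCost cur r + dist cur p : ℝ≥0∞) +
          ENNReal.ofReal (costToGo A (r :: reqs) (cur :: past) p rs) := by
      intro p
      rw [tsum_map_mul, ← ih]
      simp only [cost, Nat.cast_add, mul_add, ENNReal.tsum_add, ENNReal.tsum_mul_right,
        PMF.tsum_coe, one_mul]
    simp only [inner, add_assoc, mul_add (_ : ℝ≥0∞) (serviceCost cur r : ℝ≥0∞),
      ENNReal.tsum_add, ENNReal.tsum_mul_right, PMF.tsum_coe, one_mul]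
    rw [costToGo, ENNReal.ofReal_add (Nat.cast_nonneg _), ENNReal.ofReal_natCast, tsum_fintype,
      ENNReal.ofReal_sum_of_nonneg]
    · congr 1
      refine Finset.sum_congr rfl fun p _ => ?_
      rw [ENNReal.ofReal_mul ENNReal.toReal_nonneg, ENNReal.ofReal_toReal (PMF.apply_ne_top _ _),
        ENNReal.ofReal_add (Nat.cast_nonneg _) (hJ p), ENNReal.ofReal_natCast]
    · intro p _
      exact mul_nonneg ENNReal.toReal_nonneg (add_nonneg (Nat.cast_nonneg _) (hJ p))
    · exact Finset.sum_nonneg fun p _ =>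
        mul_nonneg ENNReal.toReal_nonneg (add_nonneg (Nat.cast_nonneg _) (hJ p))

theorem expectedCost_eq (A : OnlineAlgorithm V) (p₀ : Bisection V) (I : List (V × V)) :
    expectedCost A p₀ I = ENNReal.ofReal (costToGo A [] [] p₀ I) :=
  tsum_run_eq A I [] [] p₀

theorem costToGo_cons_pure {A : OnlineAlgorithm V} {reqs : List (V × V)} {r : V × V}
    {past : List (Bisection V)} {cur x : Bisection V} (h : A reqs r past cur = PMF.pure x)
    (rs : List (V × V)) :
    costToGo A reqs past cur (r :: rs) =
      serviceCost cur r + (dist cur x + costToGo A (r :: reqs) (cur :: past) x rs) := by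
  rw [costToGo, h, Finset.sum_eq_single x]
  · simp [PMF.pure_apply]
  · intro b _ hb
    simp [PMF.pure_apply, hb]
  · intro h; exact absurd (Finset.mem_univ _) h

theorem costToGo_cons_uniform {A : OnlineAlgorithm V} {reqs : List (V × V)} {r : V × V}
    {past : List (Bisection V)} {cur : Bisection V} {S : Finset (Bisection V)} {hS : S.Nonempty}
    (h : A reqs r past cur = PMF.uniformOfFinset S hS) (rs : List (V × V)) :
    costToGo A reqs past cur (r :: rs) =
      serviceCost cur r + (∑ p ∈ S,
        (dist cur p + costToGo A (r :: reqs) (cur :: past) p rs)) / S.card := by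
  rw [costToGo, h, Finset.sum_div, ← Finset.sum_subset (Finset.subset_univ S)]
  · congr 1
    refine Finset.sum_congr rfl fun p hp => ?_
    rw [PMF.uniformOfFinset_apply_of_mem hS hp]
    simp only [ENNReal.toReal_inv, ENNReal.toReal_natCast]
    ring
  · intro p _ hp
    rw [PMF.uniformOfFinset_apply_of_notMem hS hp]
    simp

theorem dist_self (p : Bisection V) : dist p p = 0 := hammingDist_self _

/-- Requests inside a component are ignored. -/
theorem icb_of_eq (tie : TieRule V) {reqs : List (V × V)} {r : V × V}
    (h : comp (epochState reqs).comps r.1 = comp (epochState reqs).comps r.2)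
    (past : List (Bisection V)) (cur : Bisection V) :
    icb tie reqs r past cur = PMF.pure cur := by
  simp only [icb]
  rw [if_pos h]

/-- A step in which the epoch ends. -/
theorem icb_of_empty (tie : TieRule V) {reqs : List (V × V)} {r : V × V}
    (h : comp (epochState reqs).comps r.1 ≠ comp (epochState reqs).comps r.2)
    (hP : preserving (merge (epochState reqs).comps r.1 r.2) = ∅)
    (past : List (Bisection V)) (cur : Bisection V) :
    icb tie reqs r past cur = PMF.pure cur := by
  simp only [icb]
  rw [if_neg h, dif_neg (by rw [hP]; exact Finset.not_nonempty_empty)]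

/-- A step of the first stage. -/
theorem icb_firstStage (tie : TieRule V) {reqs : List (V × V)} {r : V × V}
    (h : comp (epochState reqs).comps r.1 ≠ comp (epochState reqs).comps r.2)
    (h1 : ¬ (epochState reqs).secondStage)
    (hB : (balanced (merge (epochState reqs).comps r.1 r.2)
      (nextEstimator (merge (epochState reqs).comps r.1 r.2) (epochState reqs).estimator)
        (2 * paramD (Fintype.card V))).Nonempty)
    (past : List (Bisection V)) (cur : Bisection V) :
    ∃ x, icb tie reqs r past cur = PMF.pure x ∧
      ((x ∈ closest (merge (epochState reqs).comps r.1 r.2) cur ∧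
          x ∈ balanced (merge (epochState reqs).comps r.1 r.2)
            (nextEstimator (merge (epochState reqs).comps r.1 r.2) (epochState reqs).estimator)
              (paramD (Fintype.card V))) ∨
        (x ∈ balanced (merge (epochState reqs).comps r.1 r.2)
            (nextEstimator (merge (epochState reqs).comps r.1 r.2) (epochState reqs).estimator)
              (2 * paramD (Fintype.card V)) ∧
          ∃ y ∈ closest (merge (epochState reqs).comps r.1 r.2) cur,
            y ∉ balanced (merge (epochState reqs).comps r.1 r.2)
              (nextEstimator (merge (epochState reqs).comps r.1 r.2) (epochState reqs).estimator)
                (paramD (Fintype.card V)))) := by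
  have hP : (preserving (merge (epochState reqs).comps r.1 r.2)).Nonempty :=
    hB.mono (Finset.filter_subset _ _)
  simp only [icb]
  rw [if_neg h, dif_pos hP, dif_pos ⟨h1, hB⟩]
  split_ifs with hc
  · exact ⟨_, rfl, Or.inl ⟨Subtype.property _, hc⟩⟩
  · exact ⟨_, rfl, Or.inr ⟨Subtype.property _, _, Subtype.property _, hc⟩⟩

/-- A step of the second stage, where the current partition is kept. -/
theorem icb_secondStage_of_mem (tie : TieRule V) {reqs : List (V × V)} {r : V × V}
    (h : comp (epochState reqs).comps r.1 ≠ comp (epochState reqs).comps r.2)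
    (h2 : ((epochState reqs).next r).secondStage) {cur : Bisection V}
    (hcur : cur ∈ preserving (merge (epochState reqs).comps r.1 r.2))
    (past : List (Bisection V)) :
    icb tie reqs r past cur = PMF.pure cur := by
  rw [EpochState.next_of_nonempty h (Finset.ne_empty_of_mem hcur)] at h2
  simp only [icb]
  rw [if_neg h, dif_pos ⟨cur, hcur⟩, dif_neg, if_pos hcur]
  rintro ⟨h1, hB⟩
  exact h2.elim h1 hB.ne_empty

/-- A step of the second stage, where the current partition is replaced. -/
theorem icb_secondStage_of_notMem (tie : TieRule V) {reqs : List (V × V)} {r : V × V}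
    (h : comp (epochState reqs).comps r.1 ≠ comp (epochState reqs).comps r.2)
    (hP : (preserving (merge (epochState reqs).comps r.1 r.2)).Nonempty)
    (h2 : ((epochState reqs).next r).secondStage) {cur : Bisection V}
    (hcur : cur ∉ preserving (merge (epochState reqs).comps r.1 r.2))
    (past : List (Bisection V)) :
    icb tie reqs r past cur =
      PMF.uniformOfFinset (preserving (merge (epochState reqs).comps r.1 r.2)) hP := by
  rw [EpochState.next_of_nonempty h hP.ne_empty] at h2
  simp only [icb]
  rw [if_neg h, dif_pos hP, dif_neg, if_neg hcur]
  rintro ⟨h1, hB⟩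
  exact h2.elim h1 hB.ne_empty

end Expectation

/-! ### The potential behind the count of expensive steps -/

section Potential

variable {V : Type*} [Fintype V] [DecidableEq V]

theorem mem_multiples {q g i : ℕ} : i ∈ multiples q g ↔ (1 ≤ i ∧ i ≤ q) ∧ g ∣ i := by
  rw [multiples, Finset.mem_filter, Finset.mem_Icc]

/-- The weight of a component: its size, if this is in `R(g)`, and `q` otherwise. -/
def weight (q g : ℕ) (c : Finset V) : ℕ := if c.card ∈ multiples q g then c.card else q

/-- The potential that bounds the number of expensive steps of an epoch. -/
noncomputable def expensivePotential (C : Finset (Finset V)) (g : ℕ) : ℕ :=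
  paramQ (Fintype.card V) * paramW (Fintype.card V) * (multiples (paramQ (Fintype.card V)) g).card +
    ∑ c ∈ C, weight (paramQ (Fintype.card V)) g c

/-- If both sizes lie in R(g), then so does their sum, unless it exceeds q and the weight is capped
at q. If exactly one does, the sum is not divisible by g, so both sides of the inequality contain q.
-/
theorem weight_union_le {q g : ℕ} {a b : Finset V} (ha : a.Nonempty) (hb : b.Nonempty)
    (hab : (a ∪ b).card = a.card + b.card) :
    weight q g (a ∪ b) ≤ weight q g a + weight q g b := by
  have ha' := ha.card_pos
  have hb' := hb.card_pos
  simp only [weight, mem_multiples, hab]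
  split_ifs with h1 h2 h3 h3 h2 h3 h3
  · omega
  · exact absurd ⟨⟨hb', by omega⟩, (Nat.dvd_add_right h2.2).mp h1.2⟩ h3
  · exact absurd ⟨⟨ha', by omega⟩, (Nat.dvd_add_left h3.2).mp h1.2⟩ h2
  · omega
  · by_contra hlt
    exact h1 ⟨⟨by omega, by omega⟩, dvd_add h2.2 h3.2⟩
  · omega
  · omega
  · omega

theorem weight_le (q g : ℕ) (c : Finset V) : weight q g c ≤ q := by
  unfold weight
  split_ifs with h
  · exact (mem_multiples.mp h).1.2
  · exact le_rfl

theorem sum_weight_merge {C : Finset (Finset V)} (hC : IsPart C) {u v : V}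
    (h : comp C u ≠ comp C v) (q g : ℕ) :
    ∑ c ∈ merge C u v, weight q g c ≤ ∑ c ∈ C, weight q g c := by
  have h1 := hC.sum_merge h (weight q g)
  have h2 := weight_union_le (q := q) (g := g) (hC.nonempty _ (hC.comp_mem u))
    (hC.nonempty _ (hC.comp_mem v)) (hC.card_union_comp h)
  omega

theorem sum_weight_merge_add_le {C : Finset (Finset V)} (hC : IsPart C) {u v : V}
    (h : comp C u ≠ comp C v) {q g : ℕ} (hu : (comp C u).card ∉ multiples q g)
    (hv : (comp C v).card ∉ multiples q g) :
    ∑ c ∈ merge C u v, weight q g c + q ≤ ∑ c ∈ C, weight q g c := by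
  have h1 := hC.sum_merge h (weight q g)
  have h2 := weight_le q g (comp C u ∪ comp C v)
  have h3 : weight q g (comp C u) = q := if_neg hu
  have h4 : weight q g (comp C v) = q := if_neg hv
  omega

theorem dvd_nextEstimator (C : Finset (Finset V)) (g : ℕ) : g ∣ nextEstimator C g := by
  refine Finset.dvd_gcd fun i hi => ?_
  exact (mem_multiples.mp (Finset.mem_inter.mp hi).1).2

theorem multiples_nextEstimator_subset (C : Finset (Finset V)) (g q : ℕ) :
    multiples q (nextEstimator C g) ⊆ multiples q g := by
  intro i hi
  rw [mem_multiples] at hi ⊢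
  exact ⟨hi.1, (dvd_nextEstimator C g).trans hi.2⟩

/-- A finite estimator divides some popular size, hence is at most q. So the value ∞, written as 0,
is the only way to leave {1, …, q}. -/
theorem nextEstimator_mem {C : Finset (Finset V)} {g : ℕ} (h : nextEstimator C g ≠ 0) :
    nextEstimator C g ∈ multiples (paramQ (Fintype.card V)) g := by
  have hne : ∃ i ∈ multiples (paramQ (Fintype.card V)) g ∩ popular C, id i ≠ 0 := by
    by_contra! hcon
    exact h (Finset.gcd_eq_zero_iff.mpr hcon)
  obtain ⟨i, hi, -⟩ := hne
  have hi' := mem_multiples.mp (Finset.mem_inter.mp hi).1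
  have hle : nextEstimator C g ≤ i := Nat.le_of_dvd hi'.1.1 (Finset.gcd_dvd (f := id) hi)
  exact mem_multiples.mpr
    ⟨⟨Nat.pos_of_ne_zero h, hle.trans hi'.1.2⟩, dvd_nextEstimator C g⟩

/-- Popular sizes in R(g) are multiples of their own gcd, so only unpopular sizes drop out of R(g).
-/
theorem cnt_lt_of_mem_sdiff {C : Finset (Finset V)} {g i : ℕ}
    (hi : i ∈ multiples (paramQ (Fintype.card V)) g \
      multiples (paramQ (Fintype.card V)) (nextEstimator C g)) :
    cnt C i + 1 ≤ paramW (Fintype.card V) := by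
  rw [Finset.mem_sdiff] at hi
  by_contra hw
  refine hi.2 ?_
  have hi' := mem_multiples.mp hi.1
  refine mem_multiples.mpr ⟨hi'.1, Finset.gcd_dvd (f := id) (Finset.mem_inter.mpr ⟨hi.1, ?_⟩)⟩
  rw [popular, Finset.mem_filter, Finset.mem_Icc]
  exact ⟨hi'.1, by omega⟩

/-- Each size that drops out of R(g) releases qw. It is unpopular, so at most w - 1 components have
it, and each of them gains at most q in weight; a surplus of q per size remains. -/
theorem expensivePotential_nextEstimator (C : Finset (Finset V)) (g : ℕ) :
    expensivePotential C (nextEstimator C g) + paramQ (Fintype.card V) *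
      (multiples (paramQ (Fintype.card V)) g \
        multiples (paramQ (Fintype.card V)) (nextEstimator C g)).card ≤
      expensivePotential C g := by
  have hcnt := fun i => cnt_lt_of_mem_sdiff (C := C) (g := g) (i := i)
  have hsub := multiples_nextEstimator_subset C g (paramQ (Fintype.card V))
  unfold expensivePotential
  set q := paramQ (Fintype.card V)
  set w := paramW (Fintype.card V)
  set g' := nextEstimator C g
  set D := multiples q g \ multiples q g' with hD
  have hcard : (multiples q g).card = (multiples q g').card + D.card := by
    rw [hD, Finset.card_sdiff_of_subset hsub]
    have := Finset.card_le_card hsub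
    omega
  have h1 : ∀ c ∈ C, weight q g' c ≤ weight q g c + if c.card ∈ D then q else 0 := by
    intro c _
    by_cases hc' : c.card ∈ multiples q g'
    · have hc := hsub hc'
      simp [weight, hc, hc']
    · by_cases hc : c.card ∈ multiples q g
      · have : c.card ∈ D := Finset.mem_sdiff.mpr ⟨hc, hc'⟩
        simp [weight, this, hc']
      · simp [weight, hc, hc']
  have h2 : ∑ c ∈ C, (if c.card ∈ D then q else 0) + D.card * q ≤ D.card * w * q := by
    have : ∑ c ∈ C, (if c.card ∈ D then q else 0) = (∑ i ∈ D, cnt C i) * q := by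
      rw [← Finset.sum_filter, Finset.sum_const, smul_eq_mul]
      congr 1
      rw [Finset.card_eq_sum_card_fiberwise (f := Finset.card)
        (s := C.filter fun c => c.card ∈ D) (t := D) (fun c hc => (Finset.mem_filter.mp hc).2)]
      refine Finset.sum_congr rfl fun i hi => ?_
      rw [cnt, Finset.filter_filter]
      congr 1
      refine Finset.filter_congr fun c _ => ?_
      constructor
      · exact fun h => h.2
      · rintro rfl
        exact ⟨hi, rfl⟩
    rw [this, ← add_mul]
    gcongr
    calc ∑ i ∈ D, cnt C i + D.card = ∑ i ∈ D, (cnt C i + 1) := by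
          rw [Finset.sum_add_distrib, Finset.sum_const, smul_eq_mul, mul_one]
      _ ≤ ∑ _i ∈ D, w := Finset.sum_le_sum hcnt
      _ = D.card * w := by rw [Finset.sum_const, smul_eq_mul]
  have h3 := Finset.sum_le_sum h1
  rw [Finset.sum_add_distrib] at h3
  rw [hcard]
  nlinarith

theorem expensivePotential_step {C : Finset (Finset V)} (hC : IsPart C) {u v : V}
    (h : comp C u ≠ comp C v) (g : ℕ) :
    expensivePotential (merge C u v) (nextEstimator (merge C u v) g) ≤ expensivePotential C g := by
  have h1 := expensivePotential_nextEstimator (merge C u v) g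
  have h2 := sum_weight_merge hC h (paramQ (Fintype.card V)) g
  have h3 : expensivePotential (merge C u v) g ≤ expensivePotential C g :=
    Nat.add_le_add_left h2 _
  omega

/-- The potential falls in every step that changes the estimator or merges two components whose
sizes are not in `R(g)`. -/
theorem expensivePotential_expensive_step {C : Finset (Finset V)} (hC : IsPart C) {u v : V}
    (h : comp C u ≠ comp C v) {g : ℕ} (hg : g ∈ Finset.Icc 1 (paramQ (Fintype.card V)))
    (hexp : nextEstimator (merge C u v) g = g →
      (comp C u).card ∉ multiples (paramQ (Fintype.card V)) g ∧
        (comp C v).card ∉ multiples (paramQ (Fintype.card V)) g) :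
    expensivePotential (merge C u v) (nextEstimator (merge C u v) g) +
      paramQ (Fintype.card V) ≤ expensivePotential C g := by
  have h1 := expensivePotential_nextEstimator (merge C u v) g
  by_cases hg' : nextEstimator (merge C u v) g = g
  · obtain ⟨hu, hv⟩ := hexp hg'
    have h2 := sum_weight_merge_add_le hC h hu hv
    rw [hg']
    unfold expensivePotential
    omega
  · have h2 := sum_weight_merge hC h (paramQ (Fintype.card V)) g
    have h3 : expensivePotential (merge C u v) g ≤ expensivePotential C g :=
      Nat.add_le_add_left h2 _
    have h4 : 1 ≤ (multiples (paramQ (Fintype.card V)) g \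
        multiples (paramQ (Fintype.card V)) (nextEstimator (merge C u v) g)).card := by
      rw [Nat.one_le_iff_ne_zero, Finset.card_ne_zero]
      -- When the estimator changes, g itself leaves R(g): the new value is a proper multiple of g
      -- or 0.
      refine ⟨g, Finset.mem_sdiff.mpr ⟨mem_multiples.mpr ⟨Finset.mem_Icc.mp hg, dvd_rfl⟩, ?_⟩⟩
      intro hm
      exact hg' (Nat.dvd_antisymm (mem_multiples.mp hm).2 (dvd_nextEstimator _ g))
    have := Nat.le_mul_of_pos_right (paramQ (Fintype.card V)) h4
    omega

theorem one_le_paramQ {n : ℕ} (hn : 1 ≤ n) : 1 ≤ paramQ n := by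
  rw [paramQ, Nat.one_le_ceil_iff]
  positivity

theorem expensivePotential_start (hV : 1 ≤ Fintype.card V) :
    expensivePotential (EpochState.start V).comps (EpochState.start V).estimator =
      paramQ (Fintype.card V) ^ 2 * paramW (Fintype.card V) + Fintype.card V := by
  have hq := one_le_paramQ hV
  have h1 : multiples (paramQ (Fintype.card V)) 1 = Finset.Icc 1 (paramQ (Fintype.card V)) := by
    ext i
    simp [mem_multiples]
  have h2 : ∀ c ∈ singletons V, weight (paramQ (Fintype.card V)) 1 c = 1 := by
    intro c hc
    obtain ⟨v, -, rfl⟩ := Finset.mem_image.mp hc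
    rw [weight, h1, Finset.card_singleton, if_pos (Finset.mem_Icc.mpr ⟨le_rfl, hq⟩)]
  simp only [expensivePotential, EpochState.start]
  rw [Finset.sum_congr rfl h2, h1, Nat.card_Icc, Finset.sum_const, card_singletons, smul_eq_mul]
  simp only [Nat.add_sub_cancel, mul_one]
  ring

/-- The number of components with a size outside of `R(g)`. -/
theorem card_filter_notMem_mul_le (C : Finset (Finset V)) (g : ℕ) :
    (C.filter fun c => c.card ∉ multiples (paramQ (Fintype.card V)) g).card *
      paramQ (Fintype.card V) ≤ expensivePotential C g := by
  have h1 : (C.filter fun c => c.card ∉ multiples (paramQ (Fintype.card V)) g).card *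
      paramQ (Fintype.card V) = ∑ c ∈ C.filter fun c =>
        c.card ∉ multiples (paramQ (Fintype.card V)) g, weight (paramQ (Fintype.card V)) g c := by
    rw [← smul_eq_mul, ← Finset.sum_const]
    refine Finset.sum_congr rfl fun c hc => ?_
    rw [weight, if_neg (Finset.mem_filter.mp hc).2]
  rw [h1]
  exact (Finset.sum_le_sum_of_subset (Finset.filter_subset _ _)).trans (Nat.le_add_left _ _)

/-! ### Balance -/

theorem sum_cntSide_eq (C : Finset (Finset V)) (p : Bisection V) (y : Fin 2) (R : Finset ℕ) :
    ∑ i ∈ R, cntSide C p y i =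
      (C.filter fun c => (∀ v ∈ c, p.1 v = y) ∧ c.card ∈ R).card := by
  rw [Finset.card_eq_sum_card_fiberwise (f := Finset.card) (t := R)
    (fun c hc => (Finset.mem_filter.mp hc).2.2)]
  refine Finset.sum_congr rfl fun i hi => ?_
  rw [cntSide, Finset.filter_filter]
  congr 1
  refine Finset.filter_congr fun c _ => ?_
  constructor
  · rintro ⟨h1, rfl⟩
    exact ⟨⟨h1, hi⟩, rfl⟩
  · rintro ⟨⟨h1, -⟩, h2⟩
    exact ⟨h1, h2⟩

/-- The number of components with sizes in `R(g)` on side `y`. -/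
noncomputable def balanceSide (C : Finset (Finset V)) (g : ℕ) (p : Bisection V) (y : Fin 2) : ℕ :=
  (C.filter fun c => (∀ v ∈ c, p.1 v = y) ∧
    c.card ∈ multiples (paramQ (Fintype.card V)) g).card

theorem mem_balanced {C : Finset (Finset V)} {g l : ℕ} {p : Bisection V} :
    p ∈ balanced C g l ↔ p ∈ preserving C ∧ ∀ y, l ≤ balanceSide C g p y := by
  simp only [balanced, Finset.mem_filter, sum_cntSide_eq, balanceSide]

theorem IsPart.card_filter_meet_le {C : Finset (Finset V)} (hC : IsPart C) (F : Finset V) :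
    (C.filter fun c => ¬ Disjoint c F).card ≤ F.card := by
  have : ∀ c ∈ C.filter fun c => ¬ Disjoint c F, ∃ v, v ∈ c ∧ v ∈ F := fun c hc => by
    simpa [Finset.not_disjoint_iff] using (Finset.mem_filter.mp hc).2
  rcases isEmpty_or_nonempty V with hV | hV
  · rw [Finset.filter_false_of_mem fun c hc =>
      absurd (hC.nonempty c hc) (by simp [Finset.eq_empty_of_isEmpty])]
    exact Nat.zero_le _
  choose! f hf using this
  refine Finset.card_le_card_of_injOn f (fun c hc => (hf c hc).2) ?_
  intro c hc c' hc' h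
  refine hC.unique c (Finset.mem_filter.mp hc).1 c' (Finset.mem_filter.mp hc').1 (f c)
    (hf c hc).1 ?_
  rw [h]
  exact (hf c' hc').1

/-- A component stops counting only if it contains a moved element or is one of the two merged ones.
Components are disjoint, so at most `dist p p'` of them contain a moved element. -/
theorem balanceSide_le_add {C : Finset (Finset V)} (hC : IsPart C) (u v : V) (g : ℕ)
    (p p' : Bisection V) (y : Fin 2) :
    balanceSide C g p y ≤ balanceSide (merge C u v) g p' y + (dist p p' + 2) := by
  set F := Finset.univ.filter fun x => p.1 x ≠ p'.1 x with hF
  have hdist : dist p p' = F.card := rfl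
  have hsub : (C.filter fun c => (∀ v ∈ c, p.1 v = y) ∧
      c.card ∈ multiples (paramQ (Fintype.card V)) g) ⊆
      ((merge C u v).filter fun c => (∀ v ∈ c, p'.1 v = y) ∧
        c.card ∈ multiples (paramQ (Fintype.card V)) g) ∪
        ((C.filter fun c => ¬ Disjoint c F) ∪ {comp C u, comp C v}) := by
    intro c hc
    obtain ⟨hcC, hcy, hcR⟩ := Finset.mem_filter.mp hc
    simp only [Finset.mem_union, Finset.mem_filter, Finset.mem_insert, Finset.mem_singleton]
    by_cases h1 : Disjoint c F
    · by_cases h2 : c = comp C u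
      · exact Or.inr (Or.inr (Or.inl h2))
      by_cases h3 : c = comp C v
      · exact Or.inr (Or.inr (Or.inr h3))
      refine Or.inl ⟨(IsPart.mem_merge_iff u v c).mpr (Or.inr ⟨hcC, h2, h3⟩), fun x hx => ?_, hcR⟩
      have := Finset.disjoint_left.mp h1 hx
      simp only [hF, Finset.mem_filter, Finset.mem_univ, true_and, not_not] at this
      rw [← this, hcy x hx]
    · exact Or.inr (Or.inl ⟨hcC, h1⟩)
  have h1 := Finset.card_le_card hsub
  have h2 := hC.card_filter_meet_le F
  have h3 : ({comp C u, comp C v} : Finset (Finset V)).card ≤ 2 := Finset.card_le_two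
  have h4 := Finset.card_union_le ((merge C u v).filter fun c => (∀ v ∈ c, p'.1 v = y) ∧
        c.card ∈ multiples (paramQ (Fintype.card V)) g)
        ((C.filter fun c => ¬ Disjoint c F) ∪ {comp C u, comp C v})
  have h5 := Finset.card_union_le (C.filter fun c => ¬ Disjoint c F) {comp C u, comp C v}
  unfold balanceSide
  omega

theorem balanceSide_start (hV : 1 ≤ Fintype.card V) (p : Bisection V) (y : Fin 2) :
    2 * balanceSide (EpochState.start V).comps (EpochState.start V).estimator p y =
      Fintype.card V := by
  rw [← p.2 y, balanceSide]
  congr 1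
  have : (singletons V).filter (fun c => (∀ v ∈ c, p.1 v = y) ∧
      c.card ∈ multiples (paramQ (Fintype.card V)) 1) =
      (Finset.univ.filter fun v => p.1 v = y).image fun v => {v} := by
    have hq := one_le_paramQ hV
    ext c
    simp only [singletons, Finset.mem_filter, Finset.mem_image, Finset.mem_univ, true_and,
      mem_multiples]
    constructor
    · rintro ⟨⟨v, rfl⟩, h, -⟩
      exact ⟨v, h v (Finset.mem_singleton_self v), rfl⟩
    · rintro ⟨v, hv, rfl⟩
      refine ⟨⟨v, rfl⟩, ?_, ?_⟩
      · intro x hx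
        rwa [Finset.mem_singleton.mp hx]
      · simpa using hq
  rw [EpochState.start, this, Finset.card_image_of_injective _ Finset.singleton_injective]

end Potential

/-! ### Arithmetic of exchanges: a Bézout identity with bounded nonnegative coefficients -/

section Exchange

/-- Sizes that are available in one of two directions, and whose gcd divides `s`, can be used to
compensate for `s`, provided that each direction has some available size. -/
theorem exists_compensation {q s i₀ i₁ : ℕ} {Q : Finset ℕ} (hQ : Q ⊆ Finset.Icc 1 q)
    (σ : ℕ → Prop) (hs : s ∈ Finset.Icc 1 q) (h₀ : i₀ ∈ Finset.Icc 1 q)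
    (h₁ : i₁ ∈ Finset.Icc 1 q) (hgcd : Q.gcd id ∣ s) :
    ∃ x y : ℕ → ℕ, (∀ i, x i ≠ 0 → (i ∈ Q ∧ σ i) ∨ i = i₁) ∧
      (∀ i, y i ≠ 0 → (i ∈ Q ∧ ¬ σ i) ∨ i = i₀) ∧
      ∑ i ∈ Finset.Icc 1 q, i * x i = s + ∑ i ∈ Finset.Icc 1 q, i * y i ∧
      ∑ i ∈ Finset.Icc 1 q, i * x i ≤ q ^ 4 := by
  classical
  rw [Finset.mem_Icc] at hs h₀ h₁
  -- Bézout: s is an integer combination of the sizes in Q, with coefficients of any sign and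
  -- magnitude.
  obtain ⟨c, hc⟩ : ∃ c : ℕ → ℤ, (s : ℤ) = ∑ i ∈ Q, (i : ℤ) * c i := by
    obtain ⟨c, hc⟩ := Finset.gcd_eq_sum_mul Q fun i : ℕ => (i : ℤ)
    have hdvd : Q.gcd (fun i : ℕ => (i : ℤ)) ∣ (s : ℤ) := by
      have hcast : ((Q.gcd id : ℕ) : ℤ) ∣ s := Int.natCast_dvd_natCast.mpr hgcd
      refine dvd_trans ?_ hcast
      have : (Q.gcd fun i : ℕ => (i : ℤ)).natAbs ∣ Q.gcd id :=
        Finset.dvd_gcd fun i hi => by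
          have := Finset.gcd_dvd (f := fun i : ℕ => (i : ℤ)) hi
          exact Int.natAbs_dvd_natAbs.mpr this
      exact Int.natAbs_dvd.mp (Int.natCast_dvd_natCast.mpr this)
    obtain ⟨k, hk⟩ := hdvd
    refine ⟨fun i => c i * k, ?_⟩
    rw [hk, hc, Finset.sum_mul]
    simp only [mul_assoc]
  have hi₀ : (0 : ℤ) < i₀ := by exact_mod_cast h₀.1
  -- Each size i in Q is used only in the direction prescribed by σ i. Reducing c i or -c i modulo
  -- i₀ makes the coefficient nonnegative and less than q; the identity then holds only modulo i₀.
  set x₀ : ℕ → ℕ := fun i => if i ∈ Q ∧ σ i then (c i % i₀).toNat else 0 with hx₀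
  set y₀ : ℕ → ℕ := fun i => if i ∈ Q ∧ ¬ σ i then ((-c i) % i₀).toNat else 0 with hy₀
  set T₁ := ∑ i ∈ Finset.Icc 1 q, i * x₀ i with hT₁
  set T₀ := s + ∑ i ∈ Finset.Icc 1 q, i * y₀ i with hT₀
  have hmod : (i₀ : ℤ) ∣ (T₀ : ℤ) - T₁ := by
    have hcs : (s : ℤ) = ∑ i ∈ Finset.Icc 1 q, if i ∈ Q then (i : ℤ) * c i else 0 := by
      rw [hc, ← Finset.sum_filter]
      refine Finset.sum_congr ?_ fun _ _ => rfl
      ext i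
      rw [Finset.mem_filter]
      exact ⟨fun h => ⟨hQ h, h⟩, fun h => h.2⟩
    rw [hT₀, hT₁]
    push_cast
    rw [hcs, ← Finset.sum_add_distrib, ← Finset.sum_sub_distrib]
    refine Finset.dvd_sum fun i _ => ?_
    have e1 : ((c i % (i₀ : ℤ)).toNat : ℤ) = c i % i₀ :=
      Int.toNat_of_nonneg (Int.emod_nonneg _ hi₀.ne')
    have e2 : (((-c i) % (i₀ : ℤ)).toNat : ℤ) = (-c i) % i₀ :=
      Int.toNat_of_nonneg (Int.emod_nonneg _ hi₀.ne')
    by_cases h1 : i ∈ Q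
    · by_cases h2 : σ i
      · simp only [hx₀, hy₀, h1, h2, and_self, if_true, not_true, and_false, if_false,
          Nat.cast_zero, mul_zero, add_zero, e1]
        rw [← mul_sub]
        exact (Int.dvd_self_sub_emod).mul_left _
      · simp only [hx₀, hy₀, h1, h2, not_false_iff, and_self, if_true, and_false, if_false,
          Nat.cast_zero, mul_zero, sub_zero, e2]
        rw [← mul_add]
        refine Dvd.dvd.mul_left ?_ _
        have e3 : c i + -c i % (i₀ : ℤ) = -(-c i - -c i % (i₀ : ℤ)) := by
          generalize -c i % (i₀ : ℤ) = m
          ring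
        rw [e3, dvd_neg]
        exact Int.dvd_self_sub_emod
    · simp [hx₀, hy₀, h1]
  have hbound : ∀ f : ℕ → ℕ, (∀ i, f i ≤ i₀ - 1) → ∑ i ∈ Finset.Icc 1 q, i * f i ≤
      q * (q * (q - 1)) := by
    intro f hf
    calc ∑ i ∈ Finset.Icc 1 q, i * f i ≤ ∑ i ∈ Finset.Icc 1 q, q * (q - 1) := by
          refine Finset.sum_le_sum fun i hi => ?_
          have := (Finset.mem_Icc.mp hi).2
          have := hf i
          exact Nat.mul_le_mul (by omega) (by omega)
      _ = q * (q * (q - 1)) := by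
          rw [Finset.sum_const, Nat.card_Icc, smul_eq_mul, Nat.add_sub_cancel]
  have hlt : ∀ z : ℤ, (z % i₀).toNat ≤ i₀ - 1 := by
    intro z
    have := Int.emod_lt_of_pos z hi₀
    omega
  have hx₀le : T₁ ≤ q * (q * (q - 1)) := hbound x₀ fun i => by
    simp only [hx₀]
    split_ifs
    · exact hlt _
    · exact Nat.zero_le _
  have hy₀le : T₀ ≤ q + q * (q * (q - 1)) := Nat.add_le_add hs.2 (hbound y₀ fun i => by
    simp only [hy₀]
    split_ifs
    · exact hlt _
    · exact Nat.zero_le _)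
  have hq3 : q + q * (q * (q - 1)) ≤ q ^ 3 := by
    obtain ⟨k, rfl⟩ : ∃ k, q = k + 1 := ⟨q - 1, by omega⟩
    rw [Nat.add_sub_cancel]
    nlinarith [Nat.zero_le k]
  have hq1 : q ^ 3 ≤ q ^ 4 := Nat.pow_le_pow_right (by omega) (by norm_num)
  have hsum : ∀ (f : ℕ → ℕ) (j k : ℕ), j ∈ Finset.Icc 1 q →
      ∑ i ∈ Finset.Icc 1 q, i * (f i + if i = j then k else 0) =
        ∑ i ∈ Finset.Icc 1 q, i * f i + j * k := by
    intro f j k hj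
    simp only [mul_add, Finset.sum_add_distrib, mul_ite, mul_zero]
    rw [Finset.sum_ite_eq' (Finset.Icc 1 q) j, if_pos hj]
  have hx₀mem : ∀ i, x₀ i ≠ 0 → i ∈ Q ∧ σ i := fun i hi => by
    by_contra hcon
    exact hi (if_neg hcon)
  have hy₀mem : ∀ i, y₀ i ≠ 0 → i ∈ Q ∧ ¬ σ i := fun i hi => by
    by_contra hcon
    exact hi (if_neg hcon)
  -- The defect is a multiple k·i₀. If the left side is too large, k further copies of i₀ on the
  -- right repair it.
  rcases le_total T₀ T₁ with hle | hle
  · obtain ⟨k, hk⟩ : i₀ ∣ T₁ - T₀ := by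
      have : (i₀ : ℤ) ∣ ((T₁ - T₀ : ℕ) : ℤ) := by
        rw [Nat.cast_sub hle, ← dvd_neg, neg_sub]
        exact hmod
      exact_mod_cast this
    refine ⟨x₀, fun i => y₀ i + if i = i₀ then k else 0, fun i hi => Or.inl (hx₀mem i hi),
      fun i hi => ?_, ?_, by omega⟩
    · by_cases h : i = i₀
      · exact Or.inr h
      · simp only [if_neg h, add_zero] at hi
        exact Or.inl (hy₀mem i hi)
    · rw [hsum _ _ _ (Finset.mem_Icc.mpr h₀)]
      omega
  · obtain ⟨k, hk⟩ : i₀ ∣ T₀ - T₁ := by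
      have : (i₀ : ℤ) ∣ ((T₀ - T₁ : ℕ) : ℤ) := by
        rw [Nat.cast_sub hle]
        exact hmod
      exact_mod_cast this
    have hmul : i₁ * (k * i₀) ≤ q * (T₀ - T₁) := by
      rw [hk, mul_comm k]
      exact Nat.mul_le_mul_right _ h₁.2
    -- Only i₁ can be added on the left: i₁·(k·i₀) there and i₀·(k·(i₁ - 1)) on the right differ by
    -- exactly k·i₀. This enlarges the defect by a factor of at most q, hence the bound q · q³.
    refine ⟨fun i => x₀ i + if i = i₁ then k * i₀ else 0,
      fun i => y₀ i + if i = i₀ then k * (i₁ - 1) else 0, fun i hi => ?_, fun i hi => ?_, ?_, ?_⟩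
    · by_cases h : i = i₁
      · exact Or.inr h
      · simp only [if_neg h, add_zero] at hi
        exact Or.inl (hx₀mem i hi)
    · by_cases h : i = i₀
      · exact Or.inr h
      · simp only [if_neg h, add_zero] at hi
        exact Or.inl (hy₀mem i hi)
    · rw [hsum _ _ _ (Finset.mem_Icc.mpr h₀), hsum _ _ _ (Finset.mem_Icc.mpr h₁), ← hT₁,
        ← add_assoc, ← hT₀]
      obtain ⟨m, rfl⟩ : ∃ m, i₁ = m + 1 := ⟨i₁ - 1, by omega⟩
      rw [Nat.add_sub_cancel]
      have : T₀ = T₁ + i₀ * k := by omega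
      rw [this]
      ring
    · rw [hsum _ _ _ (Finset.mem_Icc.mpr h₁), ← hT₁]
      calc T₁ + i₁ * (k * i₀) ≤ T₁ + q * (T₀ - T₁) := Nat.add_le_add_left hmul _
        _ ≤ q * T₁ + q * (T₀ - T₁) := Nat.add_le_add_right (Nat.le_mul_of_pos_left _ (by omega)) _
        _ = q * T₀ := by rw [← mul_add]; congr 1; omega
        _ ≤ q * q ^ 3 := Nat.mul_le_mul_left _ (by omega)
        _ = q ^ 4 := by ring

end Exchange

/-! ### Swapping components between the clusters to repair a cheap merge -/

section Exchange

variable {V : Type*} [Fintype V] [DecidableEq V]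

/-- From a family of components that contains at least `M` components on side `y` of each size `i`
with `x i ≠ 0`, one can choose exactly `x i` components of each size `i`. -/
theorem exists_choice (S : Finset (Finset V)) (R : Finset ℕ) (x : ℕ → ℕ)
    (hx : ∀ i ∈ R, x i ≤ (S.filter fun c => c.card = i).card) :
    ∃ T ⊆ S, ∑ c ∈ T, c.card = ∑ i ∈ R, i * x i := by
  have : ∀ i ∈ R, ∃ T ⊆ S.filter (fun c => c.card = i), T.card = x i := fun i hi =>
    Finset.exists_subset_card_eq (hx i hi)
  choose! T hT hcard using this
  refine ⟨R.biUnion T, Finset.biUnion_subset.mpr fun i hi =>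
    (hT i hi).trans (Finset.filter_subset _ _), ?_⟩
  rw [Finset.sum_biUnion]
  · refine Finset.sum_congr rfl fun i hi => ?_
    rw [Finset.sum_congr rfl fun c hc => (Finset.mem_filter.mp (hT i hi hc)).2, Finset.sum_const,
      hcard i hi, smul_eq_mul, mul_comm]
  · intro i hi j hj hij
    rw [Function.onFun, Finset.disjoint_left]
    intro c hc hc'
    exact hij ((Finset.mem_filter.mp (hT i hi hc)).2.symm.trans
      (Finset.mem_filter.mp (hT j hj hc')).2)

theorem IsPart.card_biUnion {C : Finset (Finset V)} (hC : IsPart C) {T : Finset (Finset V)}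
    (hT : T ⊆ C) : (T.biUnion id).card = ∑ c ∈ T, c.card :=
  Finset.card_biUnion fun _ hc _ hc' h => hC.disjoint (hT hc) (hT hc') h

theorem Fin.two_eq_of_ne_of_ne {a b c : Fin 2} (h : a ≠ c) (h' : b ≠ c) : a = b := by omega

/-- Swapping two sets of the same size between the two sides yields a partition again. -/
theorem exists_swap (p : Bisection V) {y z : Fin 2} (hyz : y ≠ z) {F G : Finset V}
    (hF : ∀ v ∈ F, p.1 v = y) (hG : ∀ v ∈ G, p.1 v = z) (hcard : F.card = G.card) :
    ∃ p' : Bisection V, (∀ v ∈ F, p'.1 v = z) ∧ (∀ v ∈ G, p'.1 v = y) ∧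
      (∀ v, v ∉ F → v ∉ G → p'.1 v = p.1 v) ∧ dist p p' ≤ F.card + G.card := by
  have hdisj : Disjoint F G := by
    rw [Finset.disjoint_left]
    intro v hv hv'
    exact hyz ((hF v hv).symm.trans (hG v hv'))
  set f : V → Fin 2 := fun v => if v ∈ F then z else if v ∈ G then y else p.1 v with hf
  have fF : ∀ v ∈ F, f v = z := fun v hv => if_pos hv
  have fG : ∀ v ∈ G, f v = y := fun v hv => by
    simp only [hf]
    rw [if_neg (Finset.disjoint_right.mp hdisj hv), if_pos hv]
  have fo : ∀ v, v ∉ F → v ∉ G → f v = p.1 v := fun v h h' => by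
    simp only [hf]
    rw [if_neg h, if_neg h']
  have key : ∀ (a b : Fin 2), a ≠ b → ∀ F G : Finset V, (∀ v ∈ F, p.1 v = a) →
      (∀ v ∈ G, p.1 v = b) → F.card = G.card → (∀ v ∈ F, f v = b) → (∀ v ∈ G, f v = a) →
      (∀ v, v ∉ F → v ∉ G → f v = p.1 v) →
      (Finset.univ.filter fun v => f v = a).card = (Finset.univ.filter fun v => p.1 v = a).card := by
    intro a b hab F G hF hG hcard fF fG fo
    have h1 : Finset.univ.filter (fun v => f v = a) =
        ((Finset.univ.filter fun v => p.1 v = a) \ F) ∪ G := by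
      ext v
      simp only [Finset.mem_filter, Finset.mem_univ, true_and, Finset.mem_union,
        Finset.mem_sdiff]
      by_cases h1 : v ∈ G
      · simp [h1, fG v h1]
      by_cases h2 : v ∈ F
      · simp [h1, h2, fF v h2, hab.symm]
      · simp [h1, h2, fo v h2 h1]
    have h2 : F ⊆ Finset.univ.filter fun v => p.1 v = a := fun v hv =>
      Finset.mem_filter.mpr ⟨Finset.mem_univ v, hF v hv⟩
    rw [h1, Finset.card_union_of_disjoint, Finset.card_sdiff_of_subset h2]
    · have := Finset.card_le_card h2
      omega
    · rw [Finset.disjoint_right]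
      intro v hv hv'
      have := (Finset.mem_filter.mp (Finset.mem_sdiff.mp hv').1).2
      exact hab (this.symm.trans (hG v hv))
  refine ⟨⟨f, fun a => ?_⟩, fF, fG, fo, ?_⟩
  · rw [← p.2 a]
    by_cases ha : a = y
    · subst ha
      rw [key a z hyz F G hF hG hcard fF fG fo]
    · have : a = z := Fin.two_eq_of_ne_of_ne ha hyz.symm
      subst this
      rw [key a y hyz.symm G F hG hF hcard.symm fG fF fun v h h' => fo v h' h]
  · rw [← Finset.card_union_of_disjoint hdisj]
    refine Finset.card_le_card fun v hv => ?_
    by_contra hcon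
    rw [Finset.mem_union, not_or] at hcon
    exact (Finset.mem_filter.mp hv).2 (fo v hcon.1 hcon.2).symm

/-- If each of the two components `comp C u` and `comp C v` that are merged is on a different side,
the size of the former is in `R(g)`, and both sides contain many components with sizes in `R(g)`,
where `g` is the gcd of popular sizes, then there is a close partition that preserves the merged
components. -/
theorem exists_preserving_merge_near_aux {C : Finset (Finset V)} (hC : IsPart C) {u v : V}
    (h : comp C u ≠ comp C v) {p : Bisection V} (hp : p ∈ preserving C) {g : ℕ}
    (hg : nextEstimator (merge C u v) g = g)
    (hu : (comp C u).card ∈ multiples (paramQ (Fintype.card V)) g)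
    (hbal : ∀ y, paramQ (Fintype.card V) ^ 5 + 2 ≤ balanceSide C g p y) :
    ∃ p' ∈ preserving (merge C u v), dist p p' ≤ 2 * paramQ (Fintype.card V) ^ 4 := by
  classical
  by_cases huv : p.1 u = p.1 v
  · exact ⟨p, hC.mem_preserving_merge.mpr ⟨hp, huv⟩, by rw [dist_self]; exact Nat.zero_le _⟩
  have hpop : ∀ i, i ∈ popular (merge C u v) → paramW (Fintype.card V) ≤ cnt (merge C u v) i :=
    fun i hi => (Finset.mem_filter.mp hi).2
  rw [nextEstimator] at hg
  have hw : paramW (Fintype.card V) = 4 * paramQ (Fintype.card V) ^ 4 + 2 := rfl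
  unfold balanceSide at hbal
  set q := paramQ (Fintype.card V)
  set Q := multiples q g ∩ popular (merge C u v) with hQ
  have hQsub : Q ⊆ Finset.Icc 1 q := fun i hi =>
    Finset.mem_Icc.mpr (mem_multiples.mp (Finset.mem_inter.mp hi).1).1
  set C' := (C.erase (comp C u)).erase (comp C v) with hC'
  have hmem' : ∀ c, c ∈ C' ↔ c ∈ C ∧ c ≠ comp C u ∧ c ≠ comp C v := fun c => by
    simp only [hC', Finset.mem_erase]
    tauto
  have hcol : ∀ c ∈ C, ∃ y, ∀ x ∈ c, p.1 x = y := fun c hc => by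
    obtain ⟨x, hx⟩ := hC.nonempty c hc
    exact ⟨p.1 x, fun x' hx' => (Finset.mem_filter.mp hp).2 c hc x' hx' x hx⟩
  let S : Fin 2 → Finset (Finset V) := fun y => C'.filter fun c => ∀ x ∈ c, p.1 x = y
  -- Pigeonhole: without the two merged components, at least q⁵ components of at most q sizes remain
  -- on side y. This yields the sizes i₀ and i₁ used for compensation.
  have hS : ∀ y, ∃ i ∈ Finset.Icc 1 q, q ^ 4 ≤ ((S y).filter fun c => c.card = i).card := by
    intro y
    by_contra! hcon
    have h1 : (C.filter fun c => (∀ x ∈ c, p.1 x = y) ∧ c.card ∈ multiples q g) ⊆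
        ((S y).filter fun c => c.card ∈ Finset.Icc 1 q) ∪ {comp C u, comp C v} := by
      intro c hc
      obtain ⟨hc1, hc2, hc3⟩ := Finset.mem_filter.mp hc
      rw [Finset.mem_union, Finset.mem_filter, Finset.mem_filter, hmem', Finset.mem_insert,
        Finset.mem_singleton, Finset.mem_Icc]
      have := (mem_multiples.mp hc3).1
      tauto
    have h2 : ((S y).filter fun c => c.card ∈ Finset.Icc 1 q).card ≤ q * (q ^ 4 - 1) := by
      rw [Finset.card_eq_sum_card_fiberwise (f := Finset.card)
        (s := (S y).filter fun c => c.card ∈ Finset.Icc 1 q) (t := Finset.Icc 1 q)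
        (fun c hc => (Finset.mem_filter.mp hc).2)]
      calc _ ≤ ∑ _i ∈ Finset.Icc 1 q, (q ^ 4 - 1) := by
            refine Finset.sum_le_sum fun i hi => ?_
            have h3 := hcon i hi
            have h4 : (((S y).filter fun c => c.card ∈ Finset.Icc 1 q).filter
              fun c => c.card = i).card ≤ ((S y).filter fun c => c.card = i).card :=
              Finset.card_le_card (Finset.filter_subset_filter _ (Finset.filter_subset _ _))
            omega
        _ = q * (q ^ 4 - 1) := by
            rw [Finset.sum_const, Nat.card_Icc, smul_eq_mul, Nat.add_sub_cancel]
    have h3 := Finset.card_le_card h1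
    have h4 := Finset.card_union_le ((S y).filter fun c => c.card ∈ Finset.Icc 1 q)
      {comp C u, comp C v}
    have h5 : ({comp C u, comp C v} : Finset (Finset V)).card ≤ 2 := Finset.card_le_two
    have h6 := hbal y
    have hq : 1 ≤ q := (mem_multiples.mp hu).1.1.trans (mem_multiples.mp hu).1.2
    have h7 : q * (q ^ 4 - 1) + q = q ^ 5 := by
      have : 1 ≤ q ^ 4 := Nat.one_le_pow _ _ hq
      obtain ⟨m, hm⟩ : ∃ m, q ^ 4 = m + 1 := ⟨q ^ 4 - 1, by omega⟩
      rw [show q ^ 5 = q ^ 4 * q from pow_succ q 4, hm, Nat.add_sub_cancel]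
      ring
    omega
  set y := p.1 u with hy
  set z := p.1 v with hz
  have hyz : ∀ a, a ≠ z → a = y := fun a ha => Fin.two_eq_of_ne_of_ne ha huv
  -- A popular size has at least w - 1 = 4q⁴ + 1 components besides the new one, so at least one of
  -- the two sides holds q⁴ of them.
  have hside : ∀ i ∈ Q, ¬ (q ^ 4 ≤ ((S z).filter fun c => c.card = i).card) →
      q ^ 4 ≤ ((S y).filter fun c => c.card = i).card := by
    intro i hi hlt
    have h1 := hpop i (Finset.mem_inter.mp hi).2
    have h2 : (merge C u v).filter (fun c => c.card = i) ⊆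
        ((S y).filter fun c => c.card = i) ∪ ((S z).filter fun c => c.card = i) ∪
          {comp C u ∪ comp C v} := by
      intro c hc
      obtain ⟨hc1, hc2⟩ := Finset.mem_filter.mp hc
      rcases (IsPart.mem_merge_iff u v c).mp hc1 with hc3 | hc3
      · exact Finset.mem_union_right _ (Finset.mem_singleton.mpr hc3)
      · refine Finset.mem_union_left _ ?_
        obtain ⟨a, ha⟩ := hcol c hc3.1
        have hc4 := (hmem' c).mpr hc3
        by_cases haz : a = z
        · subst haz
          exact Finset.mem_union_right _
            (Finset.mem_filter.mpr ⟨Finset.mem_filter.mpr ⟨hc4, ha⟩, hc2⟩)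
        · rw [hyz a haz] at ha
          exact Finset.mem_union_left _
            (Finset.mem_filter.mpr ⟨Finset.mem_filter.mpr ⟨hc4, ha⟩, hc2⟩)
    have h3 := Finset.card_le_card h2
    have h4 := Finset.card_union_le
      (((S y).filter fun c => c.card = i) ∪ ((S z).filter fun c => c.card = i))
      {comp C u ∪ comp C v}
    have h5 := Finset.card_union_le ((S y).filter fun c => c.card = i)
      ((S z).filter fun c => c.card = i)
    rw [Finset.card_singleton] at h4
    rw [cnt] at h1
    omega
  obtain ⟨i₀, hi₀, hi₀'⟩ := hS y
  obtain ⟨i₁, hi₁, hi₁'⟩ := hS z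
  -- The component of u and the family T₀ will leave side y, in exchange for the family T₁ from side
  -- z. No size is used more than q⁴ times, since the total is at most q⁴, so enough components are
  -- available. The component of v stays in place.
  obtain ⟨f₁, f₀, hf₁, hf₀, hsum, hle⟩ := exists_compensation (s := (comp C u).card) hQsub
    (fun i => q ^ 4 ≤ ((S z).filter fun c => c.card = i).card)
    (Finset.mem_Icc.mpr (mem_multiples.mp hu).1) hi₀ hi₁
    (by rw [hg]; exact (mem_multiples.mp hu).2)
  have hval : ∀ f : ℕ → ℕ, ∑ i ∈ Finset.Icc 1 q, i * f i ≤ q ^ 4 → ∀ i ∈ Finset.Icc 1 q,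
      f i ≤ q ^ 4 := fun f hf i hi => by
    have h1 := Finset.single_le_sum (f := fun i => i * f i) (fun _ _ => Nat.zero_le _) hi
    exact (Nat.le_mul_of_pos_left _ (Finset.mem_Icc.mp hi).1).trans (h1.trans hf)
  obtain ⟨T₁, hT₁, hT₁s⟩ := exists_choice (S z) (Finset.Icc 1 q) f₁ fun i hi => by
    by_cases h0 : f₁ i = 0
    · rw [h0]; exact Nat.zero_le _
    refine (hval f₁ hle i hi).trans ?_
    rcases hf₁ i h0 with hi' | rfl
    · exact hi'.2
    · exact hi₁'
  obtain ⟨T₀, hT₀, hT₀s⟩ := exists_choice (S y) (Finset.Icc 1 q) f₀ fun i hi => by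
    by_cases h0 : f₀ i = 0
    · rw [h0]; exact Nat.zero_le _
    refine (hval f₀ (by omega) i hi).trans ?_
    rcases hf₀ i h0 with hi' | rfl
    · exact hside i hi'.1 hi'.2
    · exact hi₀'
  have hSC : ∀ a, S a ⊆ C := fun a c hc => ((hmem' c).mp (Finset.mem_filter.mp hc).1).1
  have hT₀' : insert (comp C u) T₀ ⊆ C :=
    Finset.insert_subset (hC.comp_mem u) (hT₀.trans (hSC y))
  have hT₁' : T₁ ⊆ C := hT₁.trans (hSC z)
  have huT₀ : comp C u ∉ T₀ := fun hmem =>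
    ((hmem' _).mp (Finset.mem_filter.mp (hT₀ hmem)).1).2.1 rfl
  have hvT₀ : comp C v ∉ insert (comp C u) T₀ := fun hmem => by
    rcases Finset.mem_insert.mp hmem with hmem | hmem
    · exact h hmem.symm
    · exact ((hmem' _).mp (Finset.mem_filter.mp (hT₀ hmem)).1).2.2 rfl
  have hvT₁ : comp C v ∉ T₁ := fun hmem =>
    ((hmem' _).mp (Finset.mem_filter.mp (hT₁ hmem)).1).2.2 rfl
  have hFcard := hC.card_biUnion hT₀'
  have hGcard := hC.card_biUnion hT₁'
  rw [Finset.sum_insert huT₀] at hFcard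
  have hin : ∀ T ⊆ C, ∀ c ∈ C, c ∉ T → ∀ x ∈ c, x ∉ T.biUnion id := by
    intro T hT c hc hcT x hx hx'
    obtain ⟨c', hc', hxc'⟩ := Finset.mem_biUnion.mp hx'
    exact hcT (hC.unique c hc c' (hT hc') x hx hxc' ▸ hc')
  obtain ⟨p', h1, h2, h3, h4⟩ := exists_swap p (y := y) (z := z) huv
    (F := (insert (comp C u) T₀).biUnion id) (G := T₁.biUnion id)
    (fun x hx => by
      obtain ⟨c, hc, hxc⟩ := Finset.mem_biUnion.mp hx
      rcases Finset.mem_insert.mp hc with rfl | hc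
      · exact (Finset.mem_filter.mp hp).2 _ (hC.comp_mem u) x hxc u (hC.mem_comp u)
      · exact (Finset.mem_filter.mp (hT₀ hc)).2 x hxc)
    (fun x hx => by
      obtain ⟨c, hc, hxc⟩ := Finset.mem_biUnion.mp hx
      exact (Finset.mem_filter.mp (hT₁ hc)).2 x hxc)
    (by omega)
  refine ⟨p', hC.mem_preserving_merge.mpr ⟨?_, ?_⟩, by omega⟩
  · refine Finset.mem_filter.mpr ⟨Finset.mem_univ _, fun c hc x hx x' hx' => ?_⟩
    by_cases hcF : c ∈ insert (comp C u) T₀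
    · rw [h1 x (Finset.mem_biUnion.mpr ⟨c, hcF, hx⟩), h1 x' (Finset.mem_biUnion.mpr ⟨c, hcF, hx'⟩)]
    by_cases hcG : c ∈ T₁
    · rw [h2 x (Finset.mem_biUnion.mpr ⟨c, hcG, hx⟩), h2 x' (Finset.mem_biUnion.mpr ⟨c, hcG, hx'⟩)]
    rw [h3 x (hin _ hT₀' c hc hcF x hx) (hin _ hT₁' c hc hcG x hx),
      h3 x' (hin _ hT₀' c hc hcF x' hx') (hin _ hT₁' c hc hcG x' hx')]
    exact (Finset.mem_filter.mp hp).2 c hc x hx x' hx'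
  · rw [h1 u (Finset.mem_biUnion.mpr ⟨_, Finset.mem_insert_self _ _, hC.mem_comp u⟩),
      h3 v (hin _ hT₀' _ (hC.comp_mem v) hvT₀ v (hC.mem_comp v))
        (hin _ hT₁' _ (hC.comp_mem v) hvT₁ v (hC.mem_comp v))]

theorem merge_comm (C : Finset (Finset V)) (u v : V) : merge C u v = merge C v u := by
  rw [merge, merge, Finset.union_comm, Finset.erase_right_comm]

theorem exists_preserving_merge_near {C : Finset (Finset V)} (hC : IsPart C) {u v : V}
    (h : comp C u ≠ comp C v) {p : Bisection V} (hp : p ∈ preserving C) {g : ℕ}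
    (hg : nextEstimator (merge C u v) g = g)
    (huv : (comp C u).card ∈ multiples (paramQ (Fintype.card V)) g ∨
      (comp C v).card ∈ multiples (paramQ (Fintype.card V)) g)
    (hbal : ∀ y, paramQ (Fintype.card V) ^ 5 + 2 ≤ balanceSide C g p y) :
    ∃ p' ∈ preserving (merge C u v), dist p p' ≤ 2 * paramQ (Fintype.card V) ^ 4 := by
  rcases huv with hu | hv
  · exact exists_preserving_merge_near_aux hC h hp hg hu hbal
  · rw [merge_comm] at hg ⊢
    exact exists_preserving_merge_near_aux hC h.symm hp hg hv hbal

end Exchange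

/-! ### Few preserving partitions in the absence of balance -/

section Counting

variable {V : Type*} [Fintype V] [DecidableEq V]

theorem IsPart.card_le {C : Finset (Finset V)} (hC : IsPart C) : C.card ≤ Fintype.card V := by
  calc C.card = ∑ _c ∈ C, 1 := by simp
    _ ≤ ∑ c ∈ C, c.card := Finset.sum_le_sum fun c hc => (hC.nonempty c hc).card_pos
    _ = (C.biUnion id).card := (hC.card_biUnion subset_rfl).symm
    _ ≤ Fintype.card V := Finset.card_le_univ _

theorem card_powerset_filter_lt {α : Type*} (C : Finset α) {n : ℕ} (hn : 2 ≤ n)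
    (hC : C.card ≤ n) (l : ℕ) : (C.powerset.filter fun T => T.card < l).card ≤ n ^ l := by
  rw [Finset.card_eq_sum_card_fiberwise (f := Finset.card)
    (s := C.powerset.filter fun T => T.card < l) (t := Finset.range l)
    (fun T hT => by simpa using (Finset.mem_filter.mp hT).2)]
  calc _ ≤ ∑ k ∈ Finset.range l, n ^ k := by
        refine Finset.sum_le_sum fun k _ => ?_
        calc _ ≤ (C.powersetCard k).card := by
              refine Finset.card_le_card fun T hT => ?_
              simp only [Finset.mem_filter, Finset.mem_powerset] at hT
              exact Finset.mem_powersetCard.mpr ⟨hT.1.1, hT.2⟩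
          _ = C.card.choose k := Finset.card_powersetCard k C
          _ ≤ C.card ^ k := Nat.choose_le_pow _ _
          _ ≤ n ^ k := Nat.pow_le_pow_left hC k
    _ ≤ n ^ l := (Nat.geomSum_lt hn fun k hk => Finset.mem_range.mp hk).le

/-- If there is no `(g, l)`-balanced partition, then there are few component-preserving ones. -/
theorem card_preserving_le {C : Finset (Finset V)} (hC : IsPart C) (hn : 2 ≤ Fintype.card V)
    {g l : ℕ} (h : balanced C g l = ∅) :
    (preserving C).card ≤ 2 * (Fintype.card V ^ l *
      2 ^ (C.filter fun c => c.card ∉ multiples (paramQ (Fintype.card V)) g).card) := by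
  classical
  have hside : ∀ p ∈ preserving C, ∃ y, balanceSide C g p y < l := by
    intro p hp
    by_contra! hcon
    have := mem_balanced.mpr ⟨hp, hcon⟩
    rw [h] at this
    exact absurd this (Finset.notMem_empty p)
  choose! side hside using hside
  set R := multiples (paramQ (Fintype.card V)) g
  set N := C.filter fun c => c.card ∉ R with hN
  -- An injective code for p: a side with fewer than l components with sizes in R(g), these
  -- components, and the components with other sizes that lie in cluster 0.
  let φ : Bisection V → Fin 2 × Finset (Finset V) × Finset (Finset V) := fun p =>
    (side p, C.filter (fun c => (∀ v ∈ c, p.1 v = side p) ∧ c.card ∈ R),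
      N.filter fun c => ∀ v ∈ c, p.1 v = 0)
  calc (preserving C).card ≤ ((Finset.univ : Finset (Fin 2)) ×ˢ
        (C.powerset.filter fun T => T.card < l) ×ˢ N.powerset).card := by
        refine Finset.card_le_card_of_injOn φ ?_ ?_
        · intro p hp
          simp only [φ, Finset.coe_product, Set.mem_prod, Finset.mem_coe, Finset.mem_univ,
            Finset.mem_filter, Finset.mem_powerset, true_and]
          exact ⟨⟨Finset.filter_subset _ _, hside p hp⟩, Finset.filter_subset _ _⟩
        · intro p hp p' hp' heq
          have hcol : ∀ (p : Bisection V), p ∈ preserving C → ∀ (u : V) (y : Fin 2),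
              p.1 u = y ↔ ∀ v ∈ comp C u, p.1 v = y := by
            intro p hp u y
            refine ⟨?_, fun h => h u (hC.mem_comp u)⟩
            rintro rfl v hv
            exact (Finset.mem_filter.mp hp).2 _ (hC.comp_mem u) v hv u (hC.mem_comp u)
          simp only [φ, Prod.mk.injEq] at heq
          obtain ⟨h1, h2, h3⟩ := heq
          refine Subtype.ext (funext fun u => ?_)
          have hcu := hC.comp_mem u
          by_cases hR : (comp C u).card ∈ R
          · have h4 : p.1 u = side p ↔ p'.1 u = side p := by
              have := Finset.ext_iff.mp h2 (comp C u)
              rw [← h1] at this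
              simp only [Finset.mem_filter, hcu, hR, true_and, and_true] at this
              rw [hcol p hp, hcol p' hp', this]
            by_cases h5 : p.1 u = side p
            · rw [h5, h4.mp h5]
            · exact Fin.two_eq_of_ne_of_ne h5 fun h => h5 (h4.mpr h)
          · have h4 : p.1 u = 0 ↔ p'.1 u = 0 := by
              have := Finset.ext_iff.mp h3 (comp C u)
              simp only [hN, Finset.mem_filter, hcu, hR, true_and, not_false_iff] at this
              rw [hcol p hp, hcol p' hp', this]
            by_cases h5 : p.1 u = 0
            · rw [h5, h4.mp h5]
            · exact Fin.two_eq_of_ne_of_ne h5 fun h => h5 (h4.mpr h)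
    _ ≤ _ := by
        rw [Finset.card_product, Finset.card_product, Finset.card_univ, Fintype.card_fin,
          Finset.card_powerset]
        gcongr
        exact card_powerset_filter_lt C hn hC.card_le l

end Counting

section Epoch

/-! ### The cost of an epoch -/

/-- The amortized cost of a cheap step of the first stage in which partitions at distance at
most `D` are available. -/
noncomputable def cheapStepCost (n D : ℕ) : ℝ := D + 1 + n * (D + 2) / paramD n

/-- A bound on the number of component-preserving partitions in the second stage. -/
noncomputable def secondStageCount (n : ℕ) : ℕ :=
  2 * (n ^ (2 * paramD n) * 2 ^ (paramQ n * paramW n + n / paramQ n))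

/-- A bound on the expected cost of the second stage. -/
noncomputable def secondStageCost (n : ℕ) : ℝ :=
  (n + 1) * (1 + Real.log (secondStageCount n)) + 1

/-- A bound on the expected cost of an epoch. -/
noncomputable def epochCost (n D : ℕ) : ℝ :=
  cheapStepCost n D * n + 2 * n * ((paramQ n ^ 2 * paramW n + n : ℕ) / paramQ n) + 2 * n +
    secondStageCost n

theorem log_natCast_nonneg (n : ℕ) : 0 ≤ Real.log n := Real.log_natCast_nonneg n

theorem one_le_secondStageCost (n : ℕ) : 1 ≤ secondStageCost n := by
  unfold secondStageCost
  have := log_natCast_nonneg (secondStageCount n)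
  have : (0 : ℝ) ≤ n := Nat.cast_nonneg n
  nlinarith [mul_nonneg this (log_natCast_nonneg (secondStageCount n))]

theorem one_le_cheapStepCost (n D : ℕ) : 1 ≤ cheapStepCost n D := by
  unfold cheapStepCost
  have : (0 : ℝ) ≤ n * (D + 2) / paramD n := by positivity
  have : (0 : ℝ) ≤ D := Nat.cast_nonneg D
  linarith

theorem epochCost_nonneg (n D : ℕ) : 0 ≤ epochCost n D := by
  have := one_le_secondStageCost n
  have := one_le_cheapStepCost n D
  unfold epochCost
  have : 0 ≤ cheapStepCost n D * n := by positivity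
  positivity

theorem one_le_paramD {n : ℕ} (hn : 2 ≤ n) : 1 ≤ paramD n := by
  rw [paramD, Nat.one_le_ceil_iff]
  have : 0 < Real.logb 2 n := Real.logb_pos (by norm_num) (by exact_mod_cast hn)
  positivity

variable {V : Type*} [Fintype V] [DecidableEq V]

/-- How much is missing for a `(g, 2d)`-balanced partition. -/
noncomputable def deficit (C : Finset (Finset V)) (g : ℕ) (p : Bisection V) : ℕ :=
  max (2 * paramD (Fintype.card V) - balanceSide C g p 0)
    (2 * paramD (Fintype.card V) - balanceSide C g p 1)

theorem deficit_le_iff {C : Finset (Finset V)} {g : ℕ} {p : Bisection V} {k : ℕ} :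
    deficit C g p ≤ k ↔ ∀ y, 2 * paramD (Fintype.card V) ≤ balanceSide C g p y + k := by
  rw [deficit, max_le_iff, Fin.forall_fin_two]
  omega

/-- A bound on the expected cost of the rest of an epoch that is in the first stage. -/
noncomputable def firstStagePotential (D : ℕ) (C : Finset (Finset V)) (g : ℕ) (p : Bisection V) :
    ℝ :=
  cheapStepCost (Fintype.card V) D * C.card +
    2 * Fintype.card V * (expensivePotential C g / paramQ (Fintype.card V)) +
    Fintype.card V * (deficit C g p / paramD (Fintype.card V)) + secondStageCost (Fintype.card V)

theorem secondStageCost_le_firstStagePotential (D : ℕ) (C : Finset (Finset V)) (g : ℕ)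
    (p : Bisection V) :
    secondStageCost (Fintype.card V) ≤ firstStagePotential D C g p := by
  have := one_le_cheapStepCost (Fintype.card V) D
  unfold firstStagePotential
  have h1 : 0 ≤ cheapStepCost (Fintype.card V) D * C.card := by positivity
  have h2 : (0 : ℝ) ≤ 2 * Fintype.card V * (expensivePotential C g / paramQ (Fintype.card V)) := by
    positivity
  have h3 : (0 : ℝ) ≤ Fintype.card V * (deficit C g p / paramD (Fintype.card V)) := by positivity
  linarith

/-- A deficit never exceeds 2d, which accounts for the summand 2n of `epochCost`. -/
theorem firstStagePotential_start_le (hn : 2 ≤ Fintype.card V) (D : ℕ) (p : Bisection V) :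
    firstStagePotential D (EpochState.start V).comps (EpochState.start V).estimator p ≤
      epochCost (Fintype.card V) D := by
  have hd : (0 : ℝ) < paramD (Fintype.card V) := by exact_mod_cast one_le_paramD hn
  have h1 : (deficit (EpochState.start V).comps (EpochState.start V).estimator p : ℝ) /
      paramD (Fintype.card V) ≤ 2 := by
    rw [div_le_iff₀ hd]
    exact_mod_cast deficit_le_iff.mpr fun y => Nat.le_add_left _ _
  have h2 : (EpochState.start V).comps.card = Fintype.card V := card_singletons
  rw [firstStagePotential, expensivePotential_start (by omega), h2, epochCost]
  have h3 := mul_le_mul_of_nonneg_left h1 (Nat.cast_nonneg (α := ℝ) (Fintype.card V))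
  linarith

/-- Every merge releases one `cheapStepCost`, as the number of components falls by one; this always
covers the service cost. The first alternative of `hD` makes the distance bound trivial and serves
small n. -/
theorem firstStagePotential_step {D : ℕ} (hn : 2 ≤ Fintype.card V) {C : Finset (Finset V)}
    (hC : IsPart C) {g : ℕ} (hg : g ∈ Finset.Icc 1 (paramQ (Fintype.card V)))
    {cur : Bisection V} (hcur : cur ∈ preserving C)
    (hD : Fintype.card V ≤ D ∨ (2 * paramQ (Fintype.card V) ^ 4 ≤ D ∧
      ∀ y, paramQ (Fintype.card V) ^ 5 + 2 ≤ balanceSide C g cur y))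
    {u v : V} (h : comp C u ≠ comp C v) {x : Bisection V}
    (hx : (x ∈ closest (merge C u v) cur ∧
        x ∈ balanced (merge C u v) (nextEstimator (merge C u v) g) (paramD (Fintype.card V))) ∨
      (x ∈ balanced (merge C u v) (nextEstimator (merge C u v) g)
          (2 * paramD (Fintype.card V)) ∧
        ∃ y ∈ closest (merge C u v) cur, y ∉ balanced (merge C u v)
          (nextEstimator (merge C u v) g) (paramD (Fintype.card V)))) :
    1 + dist cur x + firstStagePotential D (merge C u v) (nextEstimator (merge C u v) g) x ≤
      firstStagePotential D C g cur := by
  have hn0 : (0 : ℝ) ≤ (Fintype.card V : ℝ) := Nat.cast_nonneg _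
  have hd : (0 : ℝ) < paramD (Fintype.card V) := by exact_mod_cast one_le_paramD hn
  have hq : (0 : ℝ) < paramQ (Fintype.card V) := by
    exact_mod_cast one_le_paramQ (by omega : 1 ≤ Fintype.card V)
  have hcard : ((merge C u v).card : ℝ) + 1 = C.card := by exact_mod_cast hC.card_merge h
  have hdist : (dist cur x : ℝ) ≤ Fintype.card V := by exact_mod_cast dist_le_card cur x
  unfold firstStagePotential
  rw [← hcard]
  have ha := one_le_cheapStepCost (Fintype.card V) D
  by_cases hexp : nextEstimator (merge C u v) g = g →
      (comp C u).card ∉ multiples (paramQ (Fintype.card V)) g ∧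
        (comp C v).card ∉ multiples (paramQ (Fintype.card V)) g
  -- Expensive merge: the drop by q releases 2n, of which n pays for the move and n for a deficit
  -- that may have risen to d.
  · have h1 := expensivePotential_expensive_step hC h hg hexp
    have h2 : deficit (merge C u v) (nextEstimator (merge C u v) g) x ≤
        paramD (Fintype.card V) := by
      refine deficit_le_iff.mpr fun y => ?_
      rcases hx with hx | hx
      · have := (mem_balanced.mp hx.2).2 y
        omega
      · have := (mem_balanced.mp hx.1).2 y
        omega
    have h1' : (expensivePotential (merge C u v) (nextEstimator (merge C u v) g) : ℝ) /
        paramQ (Fintype.card V) + 1 ≤ expensivePotential C g / paramQ (Fintype.card V) := by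
      rw [div_add_one hq.ne']
      exact div_le_div_of_nonneg_right (by exact_mod_cast h1) hq.le
    have h2' : (deficit (merge C u v) (nextEstimator (merge C u v) g) x : ℝ) /
        paramD (Fintype.card V) ≤ 1 := by
      rw [div_le_one hd]
      exact_mod_cast h2
    have h3 : (0 : ℝ) ≤ deficit C g cur / paramD (Fintype.card V) := by positivity
    have e1 := mul_le_mul_of_nonneg_left h1' hn0
    have e2 := mul_le_mul_of_nonneg_left h2' hn0
    have e3 := mul_nonneg hn0 h3
    linarith
  -- Cheap merge: every closest partition is at distance at most D, so its deficit exceeds the old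
  -- one by at most D + 2.
  · push Not at hexp
    obtain ⟨hgg, hR⟩ := hexp
    have h1 := expensivePotential_step hC h g
    have h1' : (expensivePotential (merge C u v) (nextEstimator (merge C u v) g) : ℝ) /
        paramQ (Fintype.card V) ≤ expensivePotential C g / paramQ (Fintype.card V) :=
      div_le_div_of_nonneg_right (by exact_mod_cast h1) hq.le
    have e1 := mul_le_mul_of_nonneg_left h1' hn0
    have hclose : ∀ y ∈ closest (merge C u v) cur, dist cur y ≤ D := by
      intro y hy
      rcases hD with hD | ⟨hD, hbal⟩
      · exact (dist_le_card cur y).trans hD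
      · obtain ⟨p', hp', hle⟩ := exists_preserving_merge_near hC h hcur hgg
          (or_iff_not_imp_left.mpr hR) hbal
        exact ((Finset.mem_filter.mp hy).2 p' hp').trans (hle.trans hD)
    rw [hgg] at hx
    have hbs : ∀ (y : Bisection V), y ∈ closest (merge C u v) cur → ∀ a,
        balanceSide C g cur a ≤ balanceSide (merge C u v) g y a + (D + 2) := fun y hy a => by
      have := balanceSide_le_add hC u v g cur y a
      have := hclose y hy
      omega
    rcases hx with ⟨hx1, hx2⟩ | ⟨hx1, y, hy1, hy2⟩
    · have h2 : deficit (merge C u v) g x ≤ deficit C g cur + (D + 2) := by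
        refine deficit_le_iff.mpr fun a => ?_
        have := deficit_le_iff.mp (le_refl (deficit C g cur)) a
        have := hbs x hx1 a
        omega
      have h2' : (deficit (merge C u v) g x : ℝ) / paramD (Fintype.card V) ≤
          deficit C g cur / paramD (Fintype.card V) + (D + 2) / paramD (Fintype.card V) := by
        rw [← add_div]
        exact div_le_div_of_nonneg_right (by exact_mod_cast h2) hd.le
      have e2 := mul_le_mul_of_nonneg_left h2' hn0
      have e3 : (dist cur x : ℝ) ≤ D := by exact_mod_cast hclose x hx1
      have e4 : cheapStepCost (Fintype.card V) D = D + 1 +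
        Fintype.card V * ((D + 2) / paramD (Fintype.card V)) := by
        rw [cheapStepCost, mul_div_assoc]
      rw [hgg] at e1 ⊢
      linarith
    -- Rebalancing: the rejected candidate has deficit greater than d, so the old deficit plus D + 2
    -- is at least d. As the new deficit is 0, the released amount reaches n and pays for the move.
    · have h2 : deficit (merge C u v) g x ≤ 0 := deficit_le_iff.mpr (mem_balanced.mp hx1).2
      have h3 : paramD (Fintype.card V) ≤ deficit C g cur + (D + 2) := by
        obtain ⟨a, ha⟩ : ∃ a, balanceSide (merge C u v) g y a < paramD (Fintype.card V) := by
          by_contra! hcon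
          exact hy2 (mem_balanced.mpr ⟨(Finset.mem_filter.mp hy1).1, hcon⟩)
        have := deficit_le_iff.mp (le_refl (deficit C g cur)) a
        have := hbs y hy1 a
        omega
      have h3' : 1 ≤ deficit C g cur / paramD (Fintype.card V) +
          (D + 2 : ℝ) / paramD (Fintype.card V) := by
        rw [← add_div, one_le_div hd]
        exact_mod_cast h3
      have e2 := mul_le_mul_of_nonneg_left h3' hn0
      have e4 : cheapStepCost (Fintype.card V) D = D + 1 +
        Fintype.card V * ((D + 2) / paramD (Fintype.card V)) := by
        rw [cheapStepCost, mul_div_assoc]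
      have e5 : (0 : ℝ) ≤ D := Nat.cast_nonneg D
      rw [hgg] at e1 ⊢
      rw [Nat.le_zero.mp h2]
      push_cast
      rw [zero_div, mul_zero]
      linarith

/-! ### Reachable states -/

/-- The properties of the states of ICB that depend on the requests only. -/
structure EpochState.Reachable (s : EpochState V) : Prop where
  isPart : IsPart s.comps
  potential : expensivePotential s.comps s.estimator ≤
    paramQ (Fintype.card V) ^ 2 * paramW (Fintype.card V) + Fintype.card V
  estimator : ¬ s.secondStage → s.estimator ∈ Finset.Icc 1 (paramQ (Fintype.card V))
  count : s.secondStage → (preserving s.comps).card ≤ secondStageCount (Fintype.card V)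

theorem reachable_start (hn : 2 ≤ Fintype.card V) : (EpochState.start V).Reachable where
  isPart := isPart_singletons
  potential := (expensivePotential_start (by omega)).le
  estimator _ := Finset.mem_Icc.mpr ⟨le_rfl, one_le_paramQ (by omega)⟩
  count h := absurd h id

theorem EpochState.Reachable.next (hn : 2 ≤ Fintype.card V) {s : EpochState V} (hs : s.Reachable)
    (r : V × V) : (s.next r).Reachable := by
  by_cases h : comp s.comps r.1 = comp s.comps r.2
  · rwa [EpochState.next_of_eq h]
  by_cases hP : preserving (merge s.comps r.1 r.2) = ∅
  · rw [EpochState.next_of_empty h hP]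
    exact reachable_start hn
  rw [EpochState.next_of_nonempty h hP]
  have hq := one_le_paramQ (by omega : 1 ≤ Fintype.card V)
  have hpot := (expensivePotential_step hs.isPart h s.estimator).trans hs.potential
  refine ⟨hs.isPart.merge _ _, hpot, fun h2 => ?_, fun h2 => ?_⟩
  · simp only [not_or] at h2
    obtain ⟨h1, h2⟩ := h2
    -- With g = ∞ no component counts towards balance, so no partition is 2d-balanced, as d ≥ 1; the
    -- first stage would be over.
    have hne : nextEstimator (merge s.comps r.1 r.2) s.estimator ≠ 0 := by
      intro h0
      refine h2 (Finset.filter_eq_empty_iff.mpr fun p _ hp => ?_)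
      have h3 := hp 0
      have h4 : multiples (paramQ (Fintype.card V)) 0 = ∅ := by
        ext i
        simp only [mem_multiples, zero_dvd_iff, Finset.notMem_empty, iff_false]
        omega
      rw [h0, h4, Finset.sum_empty] at h3
      have := one_le_paramD hn
      omega
    exact Finset.mem_Icc.mpr (mem_multiples.mp (nextEstimator_mem hne)).1
  · by_cases h1 : s.secondStage
    · refine (Finset.card_le_card fun p hp => ?_).trans (hs.count h1)
      exact (hs.isPart.mem_preserving_merge.mp hp).1
    · refine (card_preserving_le (hs.isPart.merge _ _) hn (h2.resolve_left h1)).trans ?_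
      rw [secondStageCount]
      gcongr
      · exact one_le_two
      -- Each component with a size outside of R(g) weighs q, so the potential also bounds their
      -- number.
      · have h3 := (card_filter_notMem_mul_le (merge s.comps r.1 r.2)
          (nextEstimator (merge s.comps r.1 r.2) s.estimator)).trans hpot
        have h4 : paramQ (Fintype.card V) ^ 2 * paramW (Fintype.card V) + Fintype.card V =
            Fintype.card V + paramQ (Fintype.card V) *
              (paramQ (Fintype.card V) * paramW (Fintype.card V)) := by ring
        rw [h4] at h3
        have h5 := (Nat.le_div_iff_mul_le hq).mpr h3
        rw [Nat.add_mul_div_left _ _ hq] at h5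
        omega

theorem reachable_epochState (hn : 2 ≤ Fintype.card V) (reqs : List (V × V)) :
    (epochState reqs).Reachable := by
  induction reqs with
  | nil => exact reachable_start hn
  | cons r rs ih => exact ih.next hn r

end Epoch

/-! ### Induction over the remaining requests -/

section Induction

variable {V : Type*} [Fintype V] [DecidableEq V]

/-- A bound on the expected cost of the rest of an epoch that is in the second stage, when the
current partition is uniformly distributed among the `m` component-preserving ones. -/
noncomputable def uniformCost (n m : ℕ) : ℝ := (n + 1) * Real.log m + 1

/-- Bounds on the expected cost of serving the requests `rs` after the requests `reqs`. -/
structure CostBounds (tie : TieRule V) (D : ℕ) (rs reqs : List (V × V)) : Prop where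
  first : ¬ (epochState reqs).secondStage → ∀ past cur, cur ∈ preserving (epochState reqs).comps →
    (Fintype.card V ≤ D ∨ (2 * paramQ (Fintype.card V) ^ 4 ≤ D ∧ ∀ y,
      paramQ (Fintype.card V) ^ 5 + 2 ≤
        balanceSide (epochState reqs).comps (epochState reqs).estimator cur y)) →
    costToGo (icb tie) reqs past cur rs ≤
      epochCost (Fintype.card V) D * epochEnds (epochState reqs) rs +
        firstStagePotential D (epochState reqs).comps (epochState reqs).estimator cur
  second : (epochState reqs).secondStage → ∀ past cur, cur ∈ preserving (epochState reqs).comps →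
    costToGo (icb tie) reqs past cur rs ≤
      epochCost (Fintype.card V) D * epochEnds (epochState reqs) rs +
        secondStageCost (Fintype.card V)
  uniform : (epochState reqs).secondStage → ∀ past : Bisection V → List (Bisection V),
    ∑ p ∈ preserving (epochState reqs).comps, costToGo (icb tie) reqs (past p) p rs ≤
      (preserving (epochState reqs).comps).card *
        (epochCost (Fintype.card V) D * epochEnds (epochState reqs) rs +
          uniformCost (Fintype.card V) (preserving (epochState reqs).comps).card)

theorem one_le_uniformCost (n m : ℕ) : 1 ≤ uniformCost n m := by
  unfold uniformCost
  have := log_natCast_nonneg m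
  have : 0 ≤ ((n : ℝ) + 1) * Real.log m := by positivity
  linarith

/-- The extra n + 1 in `secondStageCost` pays for the first resampling, after which the current
partition is uniform. -/
theorem uniformCost_le_secondStageCost {n m : ℕ} (hm : m ≤ secondStageCount n) :
    n + 1 + uniformCost n m ≤ secondStageCost n := by
  unfold uniformCost secondStageCost
  have h1 : Real.log m ≤ Real.log (secondStageCount n) := by
    rcases Nat.eq_zero_or_pos m with rfl | h0
    · rw [Nat.cast_zero, Real.log_zero]
      exact log_natCast_nonneg _
    · exact Real.log_le_log (by exact_mod_cast h0) (by exact_mod_cast hm)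
  have h2 : ((n : ℝ) + 1) * Real.log m ≤ (n + 1) * Real.log (secondStageCount n) :=
    mul_le_mul_of_nonneg_left h1 (by positivity)
  linarith

/-- The cost of resampling is paid for by the decrease of the logarithm. -/
theorem uniformCost_resample {n m m' : ℕ} (h0 : 0 < m') (hm : m' ≤ m) (A : ℝ) :
    m' * (A + uniformCost n m') + (m - m') * (n + 1 + (A + uniformCost n m')) ≤
      m * (A + uniformCost n m) := by
  have hm'0 : (0 : ℝ) < m' := by exact_mod_cast h0
  have hm0 : (0 : ℝ) < m := by exact_mod_cast h0.trans_le hm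
  -- The inequality 1 - 1/x ≤ log x at x = m/m' bounds the fraction of partitions that are lost.
  have h1 := Real.one_sub_inv_le_log_of_pos (div_pos hm0 hm'0)
  rw [Real.log_div hm0.ne' hm'0.ne', inv_div] at h1
  have h2 : (m : ℝ) - m' ≤ m * (Real.log m - Real.log m') := by
    have := mul_le_mul_of_nonneg_left h1 hm0.le
    have e : (m : ℝ) * (1 - m' / m) = m - m' := by
      field_simp
    linarith
  have h3 := mul_le_mul_of_nonneg_left h2 (by positivity : (0 : ℝ) ≤ n + 1)
  unfold uniformCost
  linarith

theorem serviceCost_eq_zero {p : Bisection V} {r : V × V} (h : p.1 r.1 = p.1 r.2) :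
    serviceCost p r = 0 := by
  rw [serviceCost, if_neg (not_not.mpr h)]

theorem costToGo_of_eq (tie : TieRule V) {reqs : List (V × V)} {r : V × V}
    (h : comp (epochState reqs).comps r.1 = comp (epochState reqs).comps r.2)
    (past : List (Bisection V)) {cur : Bisection V}
    (hcur : cur ∈ preserving (epochState reqs).comps) (rs : List (V × V)) :
    costToGo (icb tie) reqs past cur (r :: rs) =
      costToGo (icb tie) (r :: reqs) (cur :: past) cur rs := by
  rw [costToGo_cons_pure (icb_of_eq tie h past cur), dist_self,
    serviceCost_eq_zero ((isPart_epochState reqs).eq_of_comp_eq hcur h)]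
  simp

theorem epochEnds_of_eq {s : EpochState V} {r : V × V}
    (h : comp s.comps r.1 = comp s.comps r.2) (rs : List (V × V)) :
    epochEnds s (r :: rs) = epochEnds s rs := by
  rw [epochEnds, if_neg fun h' => h'.1 h, EpochState.next_of_eq h, zero_add]

theorem epochEnds_of_nonempty {s : EpochState V} {r : V × V}
    (hP : (preserving (merge s.comps r.1 r.2)).Nonempty) (rs : List (V × V)) :
    epochEnds s (r :: rs) = epochEnds (s.next r) rs := by
  rw [epochEnds, if_neg fun h' => hP.ne_empty h'.2, zero_add]

/-- The increment of `epochEnds` pays for the whole next epoch. The remaining 1 is the service cost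
of the last request of the old epoch, for which `uniformCost` and `secondStageCost` keep a summand
1. -/
theorem costToGo_of_empty (tie : TieRule V) (hn : 2 ≤ Fintype.card V) {D : ℕ}
    (hD : Fintype.card V ≤ D ∨ (2 * paramQ (Fintype.card V) ^ 4 ≤ D ∧
      paramQ (Fintype.card V) ^ 5 + 2 ≤ paramD (Fintype.card V) ∧
      2 * (paramQ (Fintype.card V) ^ 5 + 2) ≤ Fintype.card V))
    {reqs : List (V × V)} {r : V × V} {rs : List (V × V)}
    (h : comp (epochState reqs).comps r.1 ≠ comp (epochState reqs).comps r.2)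
    (hP : preserving (merge (epochState reqs).comps r.1 r.2) = ∅)
    (ih : CostBounds tie D rs (r :: reqs)) (past : List (Bisection V)) (cur : Bisection V) :
    costToGo (icb tie) reqs past cur (r :: rs) ≤
      epochCost (Fintype.card V) D * epochEnds (epochState reqs) (r :: rs) + 1 := by
  have hnext : epochState (r :: reqs) = EpochState.start V := EpochState.next_of_empty h hP
  have h1 := ih.first
  rw [hnext] at h1
  have h2 := h1 id (cur :: past) cur (mem_preserving_start cur) (hD.imp id fun hD' =>
    ⟨hD'.1, fun y => by
      have := balanceSide_start (by omega : 1 ≤ Fintype.card V) cur y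
      omega⟩)
  rw [costToGo_cons_pure (icb_of_empty tie h hP past cur), dist_self, epochEnds,
    if_pos ⟨h, hP⟩, EpochState.next_of_empty h hP]
  have h3 : (serviceCost cur r : ℝ) ≤ 1 := by exact_mod_cast serviceCost_le_one cur r
  have h4 := firstStagePotential_start_le hn D cur
  push_cast
  linarith

/-- The cost of a step of the second stage in which the partition is replaced. -/
theorem costToGo_of_notMem (tie : TieRule V) {D : ℕ} {reqs : List (V × V)} {r : V × V}
    {rs : List (V × V)}
    (h : comp (epochState reqs).comps r.1 ≠ comp (epochState reqs).comps r.2)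
    (hP : (preserving (merge (epochState reqs).comps r.1 r.2)).Nonempty)
    (h2 : ((epochState reqs).next r).secondStage)
    (ih : CostBounds tie D rs (r :: reqs)) (past : List (Bisection V)) {cur : Bisection V}
    (hcur : cur ∉ preserving (merge (epochState reqs).comps r.1 r.2)) :
    costToGo (icb tie) reqs past cur (r :: rs) ≤ Fintype.card V + 1 +
      (epochCost (Fintype.card V) D * epochEnds (epochState reqs) (r :: rs) +
        uniformCost (Fintype.card V)
          (preserving (merge (epochState reqs).comps r.1 r.2)).card) := by
  have hcomps : (epochState (r :: reqs)).comps = merge (epochState reqs).comps r.1 r.2 := by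
    rw [epochState, EpochState.next_of_nonempty h hP.ne_empty]
  have h3 := ih.uniform h2 fun _ => cur :: past
  rw [hcomps] at h3
  rw [costToGo_cons_uniform (icb_secondStage_of_notMem tie h hP h2 hcur past),
    epochEnds_of_nonempty hP]
  have h4 : (serviceCost cur r : ℝ) ≤ 1 := by exact_mod_cast serviceCost_le_one cur r
  have hm : (0 : ℝ) < (preserving (merge (epochState reqs).comps r.1 r.2)).card := by
    exact_mod_cast hP.card_pos
  have h5 : ∑ p ∈ preserving (merge (epochState reqs).comps r.1 r.2), (dist cur p : ℝ) ≤
      (preserving (merge (epochState reqs).comps r.1 r.2)).card * Fintype.card V := by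
    rw [← nsmul_eq_mul]
    exact Finset.sum_le_card_nsmul _ _ _ fun p _ => by exact_mod_cast dist_le_card cur p
  have h6 : (∑ p ∈ preserving (merge (epochState reqs).comps r.1 r.2),
      (dist cur p + costToGo (icb tie) (r :: reqs) (cur :: past) p rs)) /
        (preserving (merge (epochState reqs).comps r.1 r.2)).card ≤ Fintype.card V +
      (epochCost (Fintype.card V) D * epochEnds ((epochState reqs).next r) rs +
        uniformCost (Fintype.card V)
          (preserving (merge (epochState reqs).comps r.1 r.2)).card) := by
    rw [div_le_iff₀' hm, Finset.sum_add_distrib, mul_add]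
    exact add_le_add h5 h3
  linarith

theorem costToGo_of_mem (tie : TieRule V) {reqs : List (V × V)} {r : V × V}
    (h : comp (epochState reqs).comps r.1 ≠ comp (epochState reqs).comps r.2)
    (h2 : ((epochState reqs).next r).secondStage) (past : List (Bisection V)) {cur : Bisection V}
    (hcur : cur ∈ preserving (merge (epochState reqs).comps r.1 r.2)) (rs : List (V × V)) :
    costToGo (icb tie) reqs past cur (r :: rs) =
      costToGo (icb tie) (r :: reqs) (cur :: past) cur rs := by
  rw [costToGo_cons_pure (icb_secondStage_of_mem tie h h2 hcur past), dist_self,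
    serviceCost_eq_zero ((isPart_epochState reqs).mem_preserving_merge.mp hcur).2]
  simp

/-- A step into the second stage or inside the second stage. -/
theorem costToGo_secondStage (tie : TieRule V) (hn : 2 ≤ Fintype.card V) {D : ℕ}
    {reqs : List (V × V)} {r : V × V} {rs : List (V × V)}
    (h : comp (epochState reqs).comps r.1 ≠ comp (epochState reqs).comps r.2)
    (hP : (preserving (merge (epochState reqs).comps r.1 r.2)).Nonempty)
    (h2 : ((epochState reqs).next r).secondStage)
    (ih : CostBounds tie D rs (r :: reqs)) (past : List (Bisection V)) (cur : Bisection V) :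
    costToGo (icb tie) reqs past cur (r :: rs) ≤
      epochCost (Fintype.card V) D * epochEnds (epochState reqs) (r :: rs) +
        secondStageCost (Fintype.card V) := by
  have hcomps : (epochState (r :: reqs)).comps = merge (epochState reqs).comps r.1 r.2 := by
    rw [epochState, EpochState.next_of_nonempty h hP.ne_empty]
  by_cases hcur : cur ∈ preserving (merge (epochState reqs).comps r.1 r.2)
  · rw [costToGo_of_mem tie h h2 past hcur, epochEnds_of_nonempty hP]
    exact ih.second h2 _ cur (hcomps ▸ hcur)
  · have h3 := costToGo_of_notMem tie h hP h2 ih past hcur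
    have h4 := (reachable_epochState hn (r :: reqs)).count h2
    rw [hcomps] at h4
    have := uniformCost_le_secondStageCost h4
    linarith

/-- The bounds for an arbitrary current partition alone would not suffice: each resampling would
cost n + 1 anew. The averaged bound `uniform` is carried along because the uniform law survives both
outcomes of a second-stage step: the partitions that are kept are uniform in the smaller P(C), and
so is a fresh sample. -/
theorem costBounds (tie : TieRule V) (hn : 2 ≤ Fintype.card V) {D : ℕ}
    (hD : Fintype.card V ≤ D ∨ (2 * paramQ (Fintype.card V) ^ 4 ≤ D ∧
      paramQ (Fintype.card V) ^ 5 + 2 ≤ paramD (Fintype.card V) ∧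
      2 * (paramQ (Fintype.card V) ^ 5 + 2) ≤ Fintype.card V))
    (rs : List (V × V)) : ∀ reqs, CostBounds tie D rs reqs := by
  induction rs with
  | nil =>
    intro reqs
    refine ⟨fun _ past cur _ _ => ?_, fun _ past cur _ => ?_, fun _ past => ?_⟩
    · have h1 := secondStageCost_le_firstStagePotential D (epochState reqs).comps
        (epochState reqs).estimator cur
      have h2 := one_le_secondStageCost (Fintype.card V)
      simp only [costToGo, epochEnds, Nat.cast_zero, mul_zero, zero_add]
      linarith
    · have h2 := one_le_secondStageCost (Fintype.card V)
      simp only [costToGo, epochEnds, Nat.cast_zero, mul_zero, zero_add]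
      linarith
    · have h2 := one_le_uniformCost (Fintype.card V) (preserving (epochState reqs).comps).card
      simp only [costToGo, epochEnds, Nat.cast_zero, mul_zero, zero_add, Finset.sum_const_zero]
      positivity
  | cons r rs IH =>
    intro reqs
    have ih := IH (r :: reqs)
    have hC := isPart_epochState reqs
    by_cases h : comp (epochState reqs).comps r.1 = comp (epochState reqs).comps r.2
    · have hnext : epochState (r :: reqs) = epochState reqs := EpochState.next_of_eq h
      obtain ⟨i1, i2, i3⟩ := ih
      rw [hnext] at i1 i2 i3
      rw [← epochEnds_of_eq h rs] at i1 i2 i3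
      refine ⟨fun h1 past cur hcur hb => ?_, fun h2 past cur hcur => ?_, fun h2 past => ?_⟩
      · rw [costToGo_of_eq tie h past hcur]
        exact i1 h1 _ cur hcur hb
      · rw [costToGo_of_eq tie h past hcur]
        exact i2 h2 _ cur hcur
      · rw [Finset.sum_congr rfl fun p hp => costToGo_of_eq tie h (past p) hp rs]
        exact i3 h2 fun p => p :: past p
    by_cases hP : preserving (merge (epochState reqs).comps r.1 r.2) = ∅
    · have key := costToGo_of_empty tie hn hD h hP ih
      have hs := one_le_secondStageCost (Fintype.card V)
      refine ⟨fun h1 past cur hcur hb => ?_, fun h2 past cur hcur => ?_, fun h2 past => ?_⟩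
      · have h1 := secondStageCost_le_firstStagePotential D (epochState reqs).comps
          (epochState reqs).estimator cur
        linarith [key past cur]
      · linarith [key past cur]
      · rw [← nsmul_eq_mul]
        refine Finset.sum_le_card_nsmul _ _ _ fun p _ => (key (past p) p).trans ?_
        have := one_le_uniformCost (Fintype.card V) (preserving (epochState reqs).comps).card
        linarith
    have hP' : (preserving (merge (epochState reqs).comps r.1 r.2)).Nonempty :=
      Finset.nonempty_iff_ne_empty.mpr hP
    have hnext : epochState (r :: reqs) = _ := EpochState.next_of_nonempty h hP
    refine ⟨fun h1 past cur hcur hb => ?_, fun h2 past cur hcur => ?_, fun h2 past => ?_⟩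
    -- If the first stage ends here, this request already follows the rule of the second stage, and
    -- the reserved `secondStageCost` takes over.
    · by_cases h2 : (epochState (r :: reqs)).secondStage
      · exact (costToGo_secondStage tie hn h hP' h2 ih past cur).trans
          (add_le_add_right (secondStageCost_le_firstStagePotential D _ _ cur) _)
      · have hB : (balanced (merge (epochState reqs).comps r.1 r.2)
            (nextEstimator (merge (epochState reqs).comps r.1 r.2) (epochState reqs).estimator)
            (2 * paramD (Fintype.card V))).Nonempty := by
          rw [hnext] at h2
          exact Finset.nonempty_iff_ne_empty.mpr fun h' => h2 (Or.inr h')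
        obtain ⟨x, hx, hx'⟩ := icb_firstStage tie h h1 hB past cur
        have hstep := firstStagePotential_step hn hC
          ((reachable_epochState hn reqs).estimator h1) hcur hb h hx'
        have hxd : x ∈ preserving (merge (epochState reqs).comps r.1 r.2) ∧ ∀ y,
            paramD (Fintype.card V) ≤ balanceSide (merge (epochState reqs).comps r.1 r.2)
              (nextEstimator (merge (epochState reqs).comps r.1 r.2)
                (epochState reqs).estimator) x y := by
          rcases hx' with hx' | hx'
          · exact mem_balanced.mp hx'.2
          · have := mem_balanced.mp hx'.1
            exact ⟨this.1, fun y => (by have := this.2 y; omega)⟩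
        have i1 := ih.first h2 (cur :: past) x
        rw [hnext] at i1
        have i2 := i1 hxd.1 (hD.imp id fun hD' => ⟨hD'.1, fun y => hD'.2.1.trans (hxd.2 y)⟩)
        rw [costToGo_cons_pure hx, epochEnds_of_nonempty hP', EpochState.next_of_nonempty h hP]
        dsimp only at i2
        have h4 : (serviceCost cur r : ℝ) ≤ 1 := by exact_mod_cast serviceCost_le_one cur r
        linarith
    · have h2' : ((epochState reqs).next r).secondStage := by
        rw [EpochState.next_of_nonempty h hP]
        exact Or.inl h2
      exact costToGo_secondStage tie hn h hP' h2' ih past cur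
    · have h2' : ((epochState reqs).next r).secondStage := by
        rw [EpochState.next_of_nonempty h hP]
        exact Or.inl h2
      have hsub : preserving (merge (epochState reqs).comps r.1 r.2) ⊆
          preserving (epochState reqs).comps := fun p hp => (hC.mem_preserving_merge.mp hp).1
      have hcomps : (epochState (r :: reqs)).comps = merge (epochState reqs).comps r.1 r.2 := by
        rw [hnext]
      -- The kept partitions carry different histories, so the averaged bound has to allow a history
      -- that depends on p.
      have i3 := ih.uniform h2' fun p => p :: past p
      rw [hcomps] at i3
      have e : epochEnds (epochState (r :: reqs)) rs = epochEnds (epochState reqs) (r :: rs) :=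
        (epochEnds_of_nonempty hP' rs).symm
      rw [e] at i3
      refine le_trans ?_ (uniformCost_resample hP'.card_pos (Finset.card_le_card hsub) _)
      rw [← Finset.sum_sdiff hsub, add_comm]
      refine add_le_add ?_ ?_
      · rw [Finset.sum_congr rfl fun p hp => costToGo_of_mem tie h h2' (past p) hp rs]
        exact i3
      · rw [← Nat.cast_sub (Finset.card_le_card hsub), ← Finset.card_sdiff_of_subset hsub,
          ← nsmul_eq_mul]
        exact Finset.sum_le_card_nsmul _ _ _ fun p hp =>
          costToGo_of_notMem tie h hP' h2' ih (past p) (Finset.mem_sdiff.mp hp).2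

/-- The competitive ratio of ICB is bounded by the cost of an epoch. -/
theorem isCompetitive_icb_epochCost (tie : TieRule V) (hn : 2 ≤ Fintype.card V) {D : ℕ}
    (hD : Fintype.card V ≤ D ∨ (2 * paramQ (Fintype.card V) ^ 4 ≤ D ∧
      paramQ (Fintype.card V) ^ 5 + 2 ≤ paramD (Fintype.card V) ∧
      2 * (paramQ (Fintype.card V) ^ 5 + 2) ≤ Fintype.card V)) {γ : ℝ}
    (hγ : epochCost (Fintype.card V) D ≤ γ) : IsCompetitive (icb tie) γ := by
  -- The additive constant pays for the epoch that is never completed.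
  refine ⟨(epochCost (Fintype.card V) D).toNNReal, fun p₀ I => ?_⟩
  rw [expectedCost_eq]
  refine ENNReal.ofReal_le_ofReal ?_
  have h1 := (costBounds tie hn hD I []).first id [] p₀ (mem_preserving_start p₀)
    (hD.imp id fun hD' => ⟨hD'.1, fun y => by
      have : 2 * balanceSide (epochState []).comps (epochState []).estimator p₀ y =
        Fintype.card V := balanceSide_start (by omega : 1 ≤ Fintype.card V) p₀ y
      omega⟩)
  have h2 : firstStagePotential D (epochState []).comps (epochState []).estimator p₀ ≤
    epochCost (Fintype.card V) D := firstStagePotential_start_le hn D p₀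
  have h3 : (epochEnds (epochState []) I : ℝ) ≤ opt p₀ I := by
    exact_mod_cast epochEnds_le_opt p₀ I
  have h4 := mul_le_mul_of_nonneg_left h3 (epochCost_nonneg (Fintype.card V) D)
  have h5 : epochCost (Fintype.card V) D * opt p₀ I ≤ γ * opt p₀ I :=
    mul_le_mul_of_nonneg_right hγ (Nat.cast_nonneg _)
  rw [Real.coe_toNNReal _ (epochCost_nonneg _ _)]
  linarith

end Induction

/-! ### Asymptotics in terms of the 14th root of n -/

section Asymptotics

/-- The parameters and the competitive ratio in terms of the 14th root `s` of `n` and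
`L = √(log n)`. -/
structure RootBounds (n : ℕ) (s L : ℝ) : Prop where
  one_le_s : 1 ≤ s
  one_le_L : 1 ≤ L
  n_eq : (n : ℝ) = s ^ 14
  L_le : L ≤ s ^ 13
  log_le : Real.log n ≤ L ^ 2
  le_q : s ^ 2 ≤ paramQ n
  q_le : (paramQ n : ℝ) ≤ 2 * s ^ 2
  le_d : s ^ 13 / L ≤ paramD n
  d_le : (paramD n : ℝ) ≤ s ^ 13 / L + 1

theorem rpow_div_fourteen (n k : ℕ) :
    (n : ℝ) ^ ((k : ℝ) / 14) = ((n : ℝ) ^ (1 / 14 : ℝ)) ^ k := by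
  rw [← Real.rpow_mul_natCast (Nat.cast_nonneg n)]
  congr 1
  ring

theorem rootBounds {n : ℕ} (hn : 2 ≤ n) :
    RootBounds n ((n : ℝ) ^ (1 / 14 : ℝ)) √(Real.logb 2 n) := by
  have hn' : (2 : ℝ) ≤ n := by exact_mod_cast hn
  have hs : 1 ≤ (n : ℝ) ^ (1 / 14 : ℝ) := Real.one_le_rpow (by linarith) (by norm_num)
  have h14 : (n : ℝ) = ((n : ℝ) ^ (1 / 14 : ℝ)) ^ 14 := by
    rw [← rpow_div_fourteen]
    norm_num
  have hlog : 1 ≤ Real.logb 2 n := by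
    rw [Real.le_logb_iff_rpow_le (by norm_num) (by linarith), Real.rpow_one]
    exact hn'
  have hlogn : Real.logb 2 n ≤ n := by
    rw [Real.logb_le_iff_le_rpow (by norm_num) (by linarith), Real.rpow_natCast]
    exact_mod_cast Nat.lt_two_pow_self.le
  have hq : (n : ℝ) ^ (1 / 7 : ℝ) = ((n : ℝ) ^ (1 / 14 : ℝ)) ^ 2 := by
    rw [← rpow_div_fourteen]
    norm_num
  have hd : (n : ℝ) ^ (13 / 14 : ℝ) = ((n : ℝ) ^ (1 / 14 : ℝ)) ^ 13 := by
    rw [← rpow_div_fourteen]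
    norm_num
  have hL : 1 ≤ √(Real.logb 2 n) := Real.one_le_sqrt.mpr hlog
  have hs2 : 1 ≤ ((n : ℝ) ^ (1 / 14 : ℝ)) ^ 2 := one_le_pow₀ hs
  refine ⟨hs, hL, h14, ?_, ?_, ?_, ?_, ?_, ?_⟩
  · refine Real.sqrt_le_iff.mpr ⟨by positivity, hlogn.trans ?_⟩
    rw [← pow_mul]
    exact h14.le.trans (pow_le_pow_right₀ hs (by norm_num))
  · rw [Real.sq_sqrt (by linarith), Real.logb, le_div_iff₀ (Real.log_pos (by norm_num))]
    have h1 : Real.log 2 ≤ 1 := by linarith [Real.log_two_lt_d9]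
    have h2 := log_natCast_nonneg n
    nlinarith
  · rw [← hq]
    exact Nat.le_ceil _
  · have := Nat.ceil_lt_add_one (by positivity : 0 ≤ (n : ℝ) ^ (1 / 7 : ℝ))
    rw [paramQ]
    rw [hq] at this ⊢
    linarith
  · rw [← hd]
    exact Nat.le_ceil _
  · rw [← hd]
    exact (Nat.ceil_lt_add_one (by positivity)).le

/-- For large `n` there are enough components on both sides. -/
theorem exists_threshold : ∃ N : ℕ, ∀ n : ℕ, N ≤ n → 2 ≤ n →
    paramQ n ^ 5 + 2 ≤ paramD n ∧ 2 * (paramQ n ^ 5 + 2) ≤ n := by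
  -- Here 1156 = 34²: since q⁵ + 2 ≤ 34s¹⁰ and d ≥ s¹³/L, the first claim follows from 34L ≤ s³,
  -- whose square is this inequality.
  have h1 : ∀ᶠ x : ℝ in Filter.atTop, 1156 * Real.logb 2 x ≤ x ^ (6 / 14 : ℝ) := by
    have h2 := (isLittleO_log_rpow_atTop (by norm_num : (0 : ℝ) < 6 / 14)).bound
      (by have := Real.log_pos (one_lt_two (α := ℝ)); positivity : 0 < Real.log 2 / 1156)
    filter_upwards [h2, Filter.eventually_ge_atTop 1] with x hx hx1
    have hl := Real.log_pos (one_lt_two (α := ℝ))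
    rw [Real.norm_of_nonneg (Real.log_nonneg hx1), Real.norm_of_nonneg (by positivity)] at hx
    rw [Real.logb, ← mul_div_assoc, div_le_iff₀ hl]
    linarith
  obtain ⟨N, hN⟩ := Filter.eventually_atTop.mp
    (tendsto_natCast_atTop_atTop.eventually h1)
  refine ⟨N, fun n hNn hn => ?_⟩
  have hn' : (2 : ℝ) ≤ n := by exact_mod_cast hn
  have hb := rootBounds hn
  have h6 : (n : ℝ) ^ (6 / 14 : ℝ) = ((n : ℝ) ^ (1 / 14 : ℝ)) ^ 6 := by
    rw [← rpow_div_fourteen]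
    norm_num
  have hlog := hN n hNn
  rw [h6] at hlog
  have hLsq : √(Real.logb 2 n) ^ 2 = Real.logb 2 n :=
    Real.sq_sqrt (Real.logb_nonneg (by norm_num) (by linarith))
  rw [← hLsq] at hlog
  generalize (n : ℝ) ^ (1 / 14 : ℝ) = s at hb hlog
  generalize √(Real.logb 2 n) = L at hb hlog
  obtain ⟨hs, hL, hns, -, -, -, hq, hd, -⟩ := hb
  have hs3 : 34 * L ≤ s ^ 3 := by
    refine (pow_le_pow_iff_left₀ (by linarith) (pow_nonneg (by linarith) 3) two_ne_zero).mp ?_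
    nlinarith
  have hq5 : (paramQ n : ℝ) ^ 5 + 2 ≤ 34 * s ^ 10 := by
    have h1 : (paramQ n : ℝ) ^ 5 ≤ (2 * s ^ 2) ^ 5 := pow_le_pow_left₀ (Nat.cast_nonneg _) hq 5
    have h2 : 1 ≤ s ^ 10 := one_le_pow₀ hs
    have h3 : (2 * s ^ 2) ^ 5 = 32 * s ^ 10 := by ring
    linarith
  have hs10 : 0 ≤ s ^ 10 := by positivity
  constructor
  · have : (paramQ n : ℝ) ^ 5 + 2 ≤ paramD n := by
      refine (hq5.trans ?_).trans hd
      rw [le_div_iff₀ (by linarith)]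
      calc 34 * s ^ 10 * L = s ^ 10 * (34 * L) := by ring
        _ ≤ s ^ 10 * s ^ 3 := mul_le_mul_of_nonneg_left hs3 hs10
        _ = s ^ 13 := by ring
    exact_mod_cast this
  · have hs2 : 2 ≤ s := by
      by_contra! hlt
      have : s ^ 3 ≤ 2 ^ 3 := pow_le_pow_left₀ (by linarith) hlt.le 3
      linarith
    have hs4 : 68 ≤ s ^ 4 := by
      have : s ^ 4 = s ^ 3 * s := by ring
      nlinarith
    have : 2 * ((paramQ n : ℝ) ^ 5 + 2) ≤ n := by
      rw [hns]
      calc 2 * ((paramQ n : ℝ) ^ 5 + 2) ≤ s ^ 10 * 68 := by linarith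
        _ ≤ s ^ 10 * s ^ 4 := mul_le_mul_of_nonneg_left hs4 hs10
        _ = s ^ 14 := by ring
    exact_mod_cast this

namespace RootBounds

variable {n : ℕ} {s L : ℝ}

theorem pow_le (h : RootBounds n s L) {k : ℕ} (hk : k ≤ 27) : s ^ k ≤ s ^ 27 * L := by
  have h1 : s ^ k ≤ s ^ 27 := pow_le_pow_right₀ h.one_le_s hk
  have h2 : 0 ≤ s ^ 27 := pow_nonneg (zero_le_one.trans h.one_le_s) 27
  nlinarith [h.one_le_L]

/-- The choice q ≈ s² balances the two summands only up to s²: qw is of order q⁵ ≈ s¹⁰, while n/q ≈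
s¹². The constant is 4·32 + 4 + 1. -/
theorem q_mul_w_add_le (h : RootBounds n s L) :
    (paramQ n * paramW n : ℝ) + n / paramQ n ≤ 133 * s ^ 12 := by
  obtain ⟨hs, -, hns, -, -, hq', hq, -, -⟩ := h
  have h0 : (0 : ℝ) < paramQ n := by nlinarith
  have h1 : (paramQ n : ℝ) ^ 5 ≤ (2 * s ^ 2) ^ 5 := pow_le_pow_left₀ h0.le hq 5
  have h2 : (2 * s ^ 2) ^ 5 = 32 * s ^ 10 := by ring
  have h3 : s ^ 10 ≤ s ^ 12 := pow_le_pow_right₀ hs (by norm_num)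
  have h4 : s ^ 2 ≤ s ^ 12 := pow_le_pow_right₀ hs (by norm_num)
  have h5 : (paramQ n * paramW n : ℝ) = 4 * (paramQ n : ℝ) ^ 5 + 2 * paramQ n := by
    rw [paramW]
    push_cast
    ring
  have h6 : (n : ℝ) / paramQ n ≤ s ^ 12 := by
    rw [div_le_iff₀ h0, hns]
    calc s ^ 14 = s ^ 12 * s ^ 2 := by ring
      _ ≤ s ^ 12 * paramQ n := mul_le_mul_of_nonneg_left hq' (by positivity)
  linarith

/-- The dominant term: d · log n ≈ (s¹³/L) · L² = s¹³L, multiplied by n = s¹⁴. The exponent qw + n/q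
contributes only s¹² to the logarithm. -/
theorem secondStageCost_le (h : RootBounds n s L) :
    secondStageCost n ≤ 279 * (s ^ 27 * L) := by
  have hqw := h.q_mul_w_add_le
  have h1 := h.pow_le (k := 0) (by norm_num)
  obtain ⟨hs, hL, hns, hLs, hlog, -, -, -, hd⟩ := h
  have hs14 : 1 ≤ s ^ 14 := one_le_pow₀ hs
  have hs0 : 0 < s := by linarith
  have hn0 : 0 < n := by
    have : (0 : ℝ) < n := by rw [hns]; positivity
    exact_mod_cast this
  have hlog2 : Real.log 2 ≤ 1 := by linarith [Real.log_two_lt_d9]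
  have hlog2' : 0 ≤ Real.log 2 := Real.log_nonneg one_le_two
  have hcount : Real.log (secondStageCount n) = Real.log 2 + (2 * paramD n * Real.log n +
      ((paramQ n * paramW n + n / paramQ n : ℕ) : ℝ) * Real.log 2) := by
    rw [secondStageCount]
    push_cast
    rw [Real.log_mul (by norm_num) (by positivity), Real.log_mul (by positivity) (by positivity),
      Real.log_pow, Real.log_pow]
    push_cast
    ring
  have hdiv : ((paramQ n * paramW n + n / paramQ n : ℕ) : ℝ) * Real.log 2 ≤ 133 * s ^ 12 := by
    have e : ((paramQ n * paramW n + n / paramQ n : ℕ) : ℝ) ≤ 133 * s ^ 12 := by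
      refine le_trans ?_ hqw
      push_cast
      exact add_le_add_right Nat.cast_div_le _
    have e' : (0 : ℝ) ≤ ((paramQ n * paramW n + n / paramQ n : ℕ) : ℝ) := Nat.cast_nonneg _
    nlinarith
  have hdlog : paramD n * Real.log n ≤ 2 * (s ^ 13 * L) := by
    calc paramD n * Real.log n ≤ (s ^ 13 / L + 1) * L ^ 2 :=
          mul_le_mul hd hlog (log_natCast_nonneg n) (by positivity)
      _ = s ^ 13 * L + L * L := by field_simp
      _ ≤ s ^ 13 * L + s ^ 13 * L := by gcongr
      _ = 2 * (s ^ 13 * L) := by ring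
  have h13 : 1 ≤ s ^ 13 * L := one_le_mul_of_one_le_of_one_le (one_le_pow₀ hs) hL
  have h12 : s ^ 12 ≤ s ^ 13 * L := by
    have e : s ^ 12 ≤ s ^ 13 := pow_le_pow_right₀ hs (by norm_num)
    have e' : 0 ≤ s ^ 13 := by positivity
    nlinarith
  have htotal : 1 + Real.log (secondStageCount n) ≤ 139 * (s ^ 13 * L) := by
    rw [hcount]
    linarith
  have hpos : 0 ≤ 1 + Real.log (secondStageCount n) := by
    linarith [log_natCast_nonneg (secondStageCount n)]
  rw [secondStageCost]
  have : ((n : ℝ) + 1) * (1 + Real.log (secondStageCount n)) ≤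
      (2 * s ^ 14) * (139 * (s ^ 13 * L)) :=
    mul_le_mul (by linarith) htotal hpos (by positivity)
  have e : (2 * s ^ 14) * (139 * (s ^ 13 * L)) = 278 * (s ^ 27 * L) := by ring
  rw [pow_zero] at h1
  linarith

/-- With D of order q⁴ ≈ s⁸, the amortized rebalancing cost nD/d is of order s⁹L per merge, hence
s²³L in n merges. -/
theorem cheapStepCost_mul_le (h : RootBounds n s L) {D : ℕ} {c : ℝ} (hc : 0 ≤ c)
    (hD : (D : ℝ) ≤ c * s ^ 8) :
    cheapStepCost n D * n ≤ (2 * c + 3) * (s ^ 27 * L) := by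
  have h22 := h.pow_le (k := 22) (by norm_num)
  obtain ⟨hs, hL, hns, -, -, -, -, hd, -⟩ := h
  have hs0 : 0 < s := by linarith
  have hL0 : 0 < L := by linarith
  have h8 : 1 ≤ s ^ 8 := one_le_pow₀ hs
  have hd0 : (0 : ℝ) < s ^ 13 / L := by positivity
  have h1 : (n * (D + 2) / paramD n : ℝ) ≤ n * ((c + 2) * s ^ 8) / (s ^ 13 / L) := by
    gcongr
    linarith
  have h2 : (n * ((c + 2) * s ^ 8) / (s ^ 13 / L) : ℝ) * n = (c + 2) * (s ^ 23 * L) := by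
    rw [hns]
    field_simp
  have h3 : s ^ 23 * L ≤ s ^ 27 * L :=
    mul_le_mul_of_nonneg_right (pow_le_pow_right₀ hs (by norm_num)) hL0.le
  have h4 : ((D : ℝ) + 1) * n ≤ (c + 1) * s ^ 22 := by
    calc ((D : ℝ) + 1) * n ≤ ((c + 1) * s ^ 8) * s ^ 14 := by
          rw [hns]
          gcongr
          linarith
      _ = (c + 1) * s ^ 22 := by ring
  have h5 := mul_le_mul_of_nonneg_right h1 (Nat.cast_nonneg (α := ℝ) n)
  rw [h2] at h5
  rw [cheapStepCost, add_mul]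
  have h6 : (c + 2) * (s ^ 23 * L) ≤ (c + 2) * (s ^ 27 * L) := by gcongr
  have h7 : (c + 1) * s ^ 22 ≤ (c + 1) * (s ^ 27 * L) := by gcongr
  linarith

theorem epochCost_le (h : RootBounds n s L) {D : ℕ} {c : ℝ} (hc : 0 ≤ c)
    (hD : (D : ℝ) ≤ c * s ^ 8) :
    epochCost n D ≤ (2 * c + 550) * (s ^ 27 * L) := by
  have h1 := h.cheapStepCost_mul_le hc hD
  have h2 := h.secondStageCost_le
  have h3 := h.q_mul_w_add_le
  have h14 := h.pow_le (k := 14) (by norm_num)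
  have h26 := h.pow_le (k := 26) (by norm_num)
  obtain ⟨hs, hL, hns, -, -, hq', -, -, -⟩ := h
  have hq0 : (0 : ℝ) < paramQ n := by nlinarith
  have h4 : (((paramQ n ^ 2 * paramW n + n : ℕ) : ℝ) / paramQ n) =
      (paramQ n * paramW n : ℝ) + n / paramQ n := by
    push_cast
    field_simp
  have h5 : 2 * (n : ℝ) * ((paramQ n * paramW n : ℝ) + n / paramQ n) ≤ 266 * s ^ 26 := by
    calc 2 * (n : ℝ) * ((paramQ n * paramW n : ℝ) + n / paramQ n) ≤
          2 * (n : ℝ) * (133 * s ^ 12) := by gcongr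
      _ = 266 * s ^ 26 := by rw [hns]; ring
  rw [epochCost, h4]
  linarith

end RootBounds

end Asymptotics

end OnlineBisection

theorem mainTheorem1 :
    ∃ C : ℝ, 0 < C ∧
      ∀ (n : ℕ), 2 ≤ n → Even n →
      ∀ (V : Type*) [Fintype V] [DecidableEq V], Fintype.card V = n →
      ∀ tie : OnlineBisection.TieRule V,
        OnlineBisection.IsCompetitive (OnlineBisection.icb tie)
          (C * ((n : ℝ) ^ (27 / 14 : ℝ) * √(Real.logb 2 (n : ℝ)))) := by
  obtain ⟨N, hN⟩ := OnlineBisection.exists_threshold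
  refine ⟨2 * (32 + N) + 550, by positivity, ?_⟩
  rintro n hn - V _ _ rfl tie
  have hb := OnlineBisection.rootBounds hn
  -- Adding N to 2q⁴ treats all n at once: for n ≤ N it makes D ≥ n, and for n ≥ N the exchange
  -- argument applies. Since 2q⁴ ≤ 32s⁸, the constant c of `epochCost_le` is 32 + N.
  refine OnlineBisection.isCompetitive_icb_epochCost tie hn
    (D := 2 * OnlineBisection.paramQ (Fintype.card V) ^ 4 + N) ?_ ?_
  · rcases le_total N (Fintype.card V) with hle | hle
    · exact Or.inr ⟨Nat.le_add_right _ _, hN _ hle hn⟩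
    · exact Or.inl (hle.trans (Nat.le_add_left _ _))
  · have h27 : (Fintype.card V : ℝ) ^ (27 / 14 : ℝ) =
        ((Fintype.card V : ℝ) ^ (1 / 14 : ℝ)) ^ 27 := by
      rw [← OnlineBisection.rpow_div_fourteen]
      norm_num
    rw [h27]
    refine hb.epochCost_le (by positivity) ?_
    have h1 := pow_le_pow_left₀ (Nat.cast_nonneg _) hb.q_le 4
    have h2 : (1 : ℝ) ≤ ((Fintype.card V : ℝ) ^ (1 / 14 : ℝ)) ^ 8 := one_le_pow₀ hb.one_le_s
    have h3 : (N : ℝ) ≤ N * ((Fintype.card V : ℝ) ^ (1 / 14 : ℝ)) ^ 8 :=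
      le_mul_of_one_le_right (Nat.cast_nonneg N) h2
    push_cast
    linarith
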